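/- Let $n\ge 2$ and let $M^n$ be a nonempty compact smooth $n$-dimensional manifold without boundary. Let $\Phi$ be a real function that is smooth on $(0,\infty)$ with $$\Phi'(x)>0,\qquad \Phi''(x)\ \ge\ -\frac{2\Phi'(x)}{x}\qquad\text{for all } x>0$$ (values of $\Phi$ outside $(0,\infty)$ are unrestricted). Let $X:M\times[0,T)\to\mathbb R^{n+1}$, $T>0$, be smooth, with each $X_t=X(\cdot,t)$ an immersion with unit normal $\nu(\cdot,t)$ depending smoothly on $(p,t)$, and suppose that $X$ solves the $\Phi(H)$-flow $$\frac{\partial X}{\partial t}(p,t)=-\Phi(H(p,t))\,\nu(p,t).$$ Here $g_{ij}=\langle\partial_iX,\partial_jX\rangle$, $h_{ij}=\langle\partial_i\nu,\partial_jX\rangle=-\langle\partial_i\partial_jX,\nu\rangle$, the Weingarten map is $h^i_j=g^{ik}h_{kj}$, the principal curvatures are its eigenvalues $\lambda_1\le\dots\le\lambda_n$, and $H=\lambda_1+\dots+\lambda_n$ (so round spheres with outer unit normal have positive curvature). The hypersurface $M_t=X_t(M)$ is called strictly convex if all its principal curvatures are positive at all points. Let $\lambda_{\min}(t)$ be the smallest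 principal curvature over all points of $M_t$. Suppose that $M_0$ is strictly convex (so that $\nu$ is the outer unit normal). Then every $M_t$, $0\le t<T$, is strictly convex, and the minimum $\lambda_{\min}(t)$ is attained. If moreover $\Phi>0$ on $(0,\infty)$, then $\lambda_{\min}(t)$ is nondecreasing in $t\in[0,T)$. -/

import Mathlib

open Set
open scoped Manifold ContDiff

noncomputable section

namespace PhiFlow

/-- The ambient Euclidean space `ℝ^{n+1}`. -/
abbrev Ambient (n : ℕ) : Type := EuclideanSpace ℝ (Fin (n + 1))

variable {n : ℕ} {M : Type*} [TopologicalSpace M] [ChartedSpace (EuclideanSpace ℝ (Fin n)) M]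

/-- `∂_i F (p)`: the derivative of `F : M → ℝ^{n+1}` at `p` in the direction of the `i`-th
coordinate vector of the tangent space at `p`. -/
def partialDeriv (F : M → Ambient n) (p : M) (i : Fin n) : Ambient n :=
  mfderiv (𝓡 n) 𝓘(ℝ, Ambient n) F p (EuclideanSpace.single i (1 : ℝ) : EuclideanSpace ℝ (Fin n))

/-- The induced metric `g_{ij} = ⟨∂_i X, ∂_j X⟩`. -/
def metric (X : M → Ambient n) (p : M) : Matrix (Fin n) (Fin n) ℝ :=
  Matrix.of fun i j => inner ℝ (partialDeriv X p i) (partialDeriv X p j)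

/-- The second fundamental form `h_{ij} = ⟨∂_i ν, ∂_j X⟩ (= -⟨∂_i ∂_j X, ν⟩)` with respect to the
unit normal `ν`. The sign is such that a round sphere with its outer unit normal has positive
definite second fundamental form. -/
def secondForm (X ν : M → Ambient n) (p : M) : Matrix (Fin n) (Fin n) ℝ :=
  Matrix.of fun i j => inner ℝ (partialDeriv ν p i) (partialDeriv X p j)

/-- The Weingarten map `h^i_j = g^{ik} h_{kj}`. -/
def weingarten (X ν : M → Ambient n) (p : M) : Matrix (Fin n) (Fin n) ℝ :=
  (metric X p)⁻¹ * secondForm X ν p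

/-- The mean curvature `H = h^i_i`. -/
def meanCurvature (X ν : M → Ambient n) (p : M) : ℝ :=
  (weingarten X ν p).trace

/-- `κ` is a principal curvature at `p`: an eigenvalue of the Weingarten map. -/
def IsPrincipalCurvature (X ν : M → Ambient n) (p : M) (κ : ℝ) : Prop :=
  Module.End.HasEigenvalue (Matrix.toLin' (weingarten X ν p)) κ

/-- The set of all principal curvatures at all points of the hypersurface. -/
def principalCurvatures (X ν : M → Ambient n) : Set ℝ :=
  {κ | ∃ p, IsPrincipalCurvature X ν p κ}

/-- A hypersurface is strictly convex if all principal curvatures are positive everywhere. -/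
def StrictlyConvex (X ν : M → Ambient n) : Prop :=
  ∀ p κ, IsPrincipalCurvature X ν p κ → 0 < κ

/-- `λ_min`, the smallest principal curvature over the whole hypersurface. -/
def lambdaMin (X ν : M → Ambient n) : ℝ :=
  sInf (principalCurvatures X ν)

/-- `X t : M → ℝ^{n+1}`, `0 ≤ t < T`, is a smooth family of immersions with unit normals `ν t`
solving `∂X/∂t = -Φ(H) ν`. If `X 0` is strictly convex with respect to `ν 0`, then `ν` is the
outer unit normal. The speed `Φ` is a function on `(0, ∞)`, extended to `ℝ` arbitrarily;
positivity of `H` is not part of the definition. -/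
structure IsFlow (Φ : ℝ → ℝ) (T : ℝ) (X ν : ℝ → M → Ambient n) : Prop where
  smooth : ContMDiffOn ((𝓡 n).prod 𝓘(ℝ, ℝ)) 𝓘(ℝ, Ambient n) ∞
    (fun q : M × ℝ => X q.2 q.1) (univ ×ˢ Ico 0 T)
  smooth_normal : ContMDiffOn ((𝓡 n).prod 𝓘(ℝ, ℝ)) 𝓘(ℝ, Ambient n) ∞
    (fun q : M × ℝ => ν q.2 q.1) (univ ×ˢ Ico 0 T)
  immersion : ∀ t ∈ Ico 0 T, ∀ p,
    Function.Injective (mfderiv (𝓡 n) 𝓘(ℝ, Ambient n) (X t) p)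
  norm_normal : ∀ t ∈ Ico 0 T, ∀ p, ‖ν t p‖ = 1
  inner_normal : ∀ t ∈ Ico 0 T, ∀ p i, inner ℝ (ν t p) (partialDeriv (X t) p i) = 0
  evolution : ∀ t ∈ Ico 0 T, ∀ p,
    HasDerivWithinAt (fun s => X s p) (-(Φ (meanCurvature (X t) (ν t) p)) • ν t p) (Ico 0 T) t

end PhiFlow

end

/-! The proof is a maximum principle for the least principal curvature, run with barriers so that
`lambdaMin` is never differentiated. Let a function φ of time stay below `lambdaMin` until it meets
it at a time t > 0, with value λ = φ(t) > 0, at a point p in a unit principal direction e. Then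
h(e,e) - φ g(e,e) at p is nonnegative before t and zero at t, so its time derivative at t is at most
0. In coordinates adapted to p, ∂ₜg(e,e) = -2Φ h(e,e) and ∂ₜh(e,e) = ∂ₑ∂ₑ(Φ(H)) - Φ|∂ₑν|², so that
derivative equals ∂ₑ∂ₑ(Φ(H)) + Φ(H)λ² - φ'(t). Hence φ'(t) ≥ Φ(H)λ² once ∂ₑ∂ₑ(Φ(H)) ≥ 0
(`IsFlow.touching`).

The heart of the matter is this last inequality, which concerns a single time slice. If h ≥ λg near
p with equality in the direction e at p, then H ∂ₑ∂ₑH ≥ 2(∂ₑH)² at p (`graphCurvature_inequality`),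
and Φ'' ≥ -2Φ'/x is exactly what turns this into ∂ₑ∂ₑ(Φ(H)) ≥ 0. To see it, write the slice as the
graph of -u over its tangent plane at p, in a basis diagonalizing the Hessian of u with eigenvalues
l. The second derivative test for h - λg along each basis line, on a direction that moves with the
point, bounds the fourth derivatives of u below by terms containing 2 Σ (third derivatives)²/l
(`fourth_deriv_lower_bound`). Summation over the basis and Cauchy-Schwarz give the claim.

It remains to choose barriers. If Φ > 0, a decreasing linear barrier cannot be touched, so
`lambdaMin` is nondecreasing. Without a sign on Φ, the hypothesis makes x²Φ' nondecreasing, so Φ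
tends to -∞ at 0 no faster than -1/x; hence Φ(H)λ² ≥ -Kλ while H is bounded, and an exponential
decaying faster than rate K cannot be touched. This keeps `lambdaMin` positive. -/

open Filter Topology

namespace PhiFlow

/-! ### Second-order jets of functions of one variable -/

/-- `f` is differentiable near `0` and twice differentiable at `0`, with value `a`, first
derivative `b` and second derivative `c` at `0`. -/
def HasTwoDeriv (f : ℝ → ℝ) (a b c : ℝ) : Prop :=
  f 0 = a ∧ ∃ f' : ℝ → ℝ, (∀ᶠ s in 𝓝 0, HasDerivAt f (f' s) s) ∧ f' 0 = b ∧ HasDerivAt f' c 0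

namespace HasTwoDeriv

variable {f g : ℝ → ℝ} {a b c a' b' c' : ℝ}

theorem const (a : ℝ) : HasTwoDeriv (fun _ => a) a 0 0 :=
  ⟨rfl, fun _ => 0, .of_forall fun s => hasDerivAt_const s a, rfl, hasDerivAt_const 0 0⟩

theorem id : HasTwoDeriv (fun s => s) 0 1 0 :=
  ⟨rfl, fun _ => 1, .of_forall fun s => hasDerivAt_id s, rfl, hasDerivAt_const 0 1⟩

theorem add (hf : HasTwoDeriv f a b c) (hg : HasTwoDeriv g a' b' c') :
    HasTwoDeriv (fun s => f s + g s) (a + a') (b + b') (c + c') := by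
  obtain ⟨rfl, f', hf, rfl, hf'⟩ := hf
  obtain ⟨rfl, g', hg, rfl, hg'⟩ := hg
  refine ⟨rfl, fun s => f' s + g' s, ?_, rfl, hf'.add hg'⟩
  filter_upwards [hf, hg] with s h1 h2 using h1.add h2

theorem mul (hf : HasTwoDeriv f a b c) (hg : HasTwoDeriv g a' b' c') :
    HasTwoDeriv (fun s => f s * g s) (a * a') (b * a' + a * b')
      (c * a' + 2 * (b * b') + a * c') := by
  obtain ⟨rfl, f', hf, rfl, hf'⟩ := hf
  obtain ⟨rfl, g', hg, rfl, hg'⟩ := hg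
  refine ⟨rfl, fun s => f' s * g s + f s * g' s, ?_, rfl, ?_⟩
  · filter_upwards [hf, hg] with s h1 h2 using h1.mul h2
  · exact ((hf'.mul hg.self_of_nhds).add (hf.self_of_nhds.mul hg')).congr_deriv (by ring)

theorem const_mul (k : ℝ) (hf : HasTwoDeriv f a b c) :
    HasTwoDeriv (fun s => k * f s) (k * a) (k * b) (k * c) := by
  simpa using (const k).mul hf

theorem sub (hf : HasTwoDeriv f a b c) (hg : HasTwoDeriv g a' b' c') :
    HasTwoDeriv (fun s => f s - g s) (a - a') (b - b') (c - c') := by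
  simpa [sub_eq_add_neg] using hf.add (hg.const_mul (-1))

theorem sum {ι : Type*} (t : Finset ι) {F : ι → ℝ → ℝ} {a b c : ι → ℝ}
    (h : ∀ i ∈ t, HasTwoDeriv (F i) (a i) (b i) (c i)) :
    HasTwoDeriv (fun s => ∑ i ∈ t, F i s) (∑ i ∈ t, a i) (∑ i ∈ t, b i) (∑ i ∈ t, c i) := by
  classical
  induction t using Finset.induction_on with
  | empty => simpa using const 0
  | insert i t hi ih =>
    simp only [Finset.sum_insert hi]
    exact (h i (Finset.mem_insert_self i t)).add
      (ih fun j hj => h j (Finset.mem_insert_of_mem hj))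

theorem comp {φ φ' : ℝ → ℝ} {d : ℝ} (hφ : ∀ᶠ x in 𝓝 a, HasDerivAt φ (φ' x) x)
    (hφ' : HasDerivAt φ' d a) (hf : HasTwoDeriv f a b c) :
    HasTwoDeriv (fun s => φ (f s)) (φ a) (φ' a * b) (d * b ^ 2 + φ' a * c) := by
  obtain ⟨rfl, f', hf, rfl, hf'⟩ := hf
  have hc : ContinuousAt f 0 := hf.self_of_nhds.continuousAt
  refine ⟨rfl, fun s => φ' (f s) * f' s, ?_, rfl, ?_⟩
  · filter_upwards [hf, hc.eventually hφ] with s h1 h2 using h2.comp s h1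
  · refine ((HasDerivAt.comp (0 : ℝ) hφ' hf.self_of_nhds).mul hf').congr_deriv ?_
    simp only [Function.comp]
    ring

theorem congr (hf : HasTwoDeriv f a b c) (h : f =ᶠ[𝓝 0] g) : HasTwoDeriv g a b c := by
  obtain ⟨rfl, f', hf, rfl, hf'⟩ := hf
  refine ⟨h.self_of_nhds.symm, f', ?_, rfl, hf'⟩
  filter_upwards [hf, h.eventuallyEq_nhds] with s h1 h2 using h1.congr_of_eventuallyEq h2.symm

theorem unique (hf : HasTwoDeriv f a b c) (hg : HasTwoDeriv f a' b' c') :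
    a = a' ∧ b = b' ∧ c = c' := by
  obtain ⟨rfl, f', hf, rfl, hf'⟩ := hf
  obtain ⟨rfl, g', hg, rfl, hg'⟩ := hg
  have h : f' =ᶠ[𝓝 0] g' := by
    filter_upwards [hf, hg] with s h1 h2 using h1.unique h2
  exact ⟨rfl, h.self_of_nhds, hf'.unique (hg'.congr_of_eventuallyEq h)⟩

/-- If c < 0, the second derivative test makes 0 a local maximum as well, so f is locally constant
and c = 0. -/
theorem nonneg_of_isLocalMin (hf : HasTwoDeriv f a b c) (h : IsLocalMin f 0) : 0 ≤ c := by
  by_contra! hc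
  have hf₀ := hf
  obtain ⟨rfl, f', hf, rfl, hf'⟩ := hf
  have hb : f' 0 = 0 := h.hasDerivAt_eq_zero hf.self_of_nhds
  have hd : deriv f =ᶠ[𝓝 0] f' := by
    filter_upwards [hf] with s hs using hs.deriv
  have hm : IsLocalMax f 0 := by
    refine isLocalMax_of_deriv_deriv_neg ?_ ?_ hf.self_of_nhds.continuousAt
    · rw [hd.deriv_eq, hf'.deriv]; exact hc
    · rw [hd.self_of_nhds, hb]
  have he : (fun _ => f 0) =ᶠ[𝓝 0] f := by
    filter_upwards [h, hm] with s h1 h2 using le_antisymm h1 h2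
  have := ((const (f 0)).congr he).unique hf₀
  exact hc.ne this.2.2.symm

end HasTwoDeriv

/-! ### Calculus of directional derivatives -/

section Directional

variable {V W : Type*} [NormedAddCommGroup V] [NormedSpace ℝ V] [NormedAddCommGroup W]

theorem two_le_infty : (2 : WithTop ℕ∞) ≤ ∞ := by
  exact WithTop.coe_le_coe.2 (le_top : (2 : ℕ∞) ≤ ⊤)

/-- The directional derivative of `f` in the constant direction `v`. -/
noncomputable def dir [NormedSpace ℝ W] (v : V) (f : V → W) (x : V) : W := fderiv ℝ f x v

theorem contDiff_dir [NormedSpace ℝ W] {f : V → W} (hf : ContDiff ℝ ∞ f) (v : V) :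
    ContDiff ℝ ∞ (dir v f) :=
  (hf.fderiv_right (m := ∞) (by simp)).clm_apply contDiff_const

theorem dir_comm [NormedSpace ℝ W] {f : V → W} (hf : ContDiff ℝ ∞ f) (v w : V) :
    dir v (dir w f) = dir w (dir v f) := by
  have key : ∀ (v w : V) (x : V), dir v (dir w f) x = fderiv ℝ (fderiv ℝ f) x v w := by
    intro v w x
    have hd : DifferentiableAt ℝ (fderiv ℝ f) x :=
      ((hf.fderiv_right (m := 1) (by norm_num; exact two_le_infty)).differentiable (by norm_num)) x
    have := (hd.hasFDerivAt.clm_apply (hasFDerivAt_const w x)).fderiv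
    simp only [dir]
    erw [this]
    simp
  funext x
  rw [key, key]
  exact (hf.contDiffAt.isSymmSndFDerivAt (by simpa using two_le_infty)) v w

theorem dir_congr [NormedSpace ℝ W] {f g : V → W} {x : V} (h : f =ᶠ[𝓝 x] g) (v : V) :
    dir v f =ᶠ[𝓝 x] dir v g := by
  filter_upwards [h.eventuallyEq_nhds] with y hy
  simp only [dir, hy.fderiv_eq]

theorem dir_add_left [NormedSpace ℝ W] (v w : V) (f : V → W) (x : V) :
    dir (v + w) f x = dir v f x + dir w f x := by simp [dir]

theorem dir_smul_left [NormedSpace ℝ W] (a : ℝ) (v : V) (f : V → W) (x : V) :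
    dir (a • v) f x = a • dir v f x := by simp [dir]

theorem dir_inner [InnerProductSpace ℝ W] {f g : V → W} {x : V} (hf : DifferentiableAt ℝ f x)
    (hg : DifferentiableAt ℝ g x) (v : V) :
    dir v (fun y => inner ℝ (f y) (g y)) x = inner ℝ (dir v f x) (g x) + inner ℝ (f x) (dir v g x) := by
  rw [dir, fderiv_inner_apply ℝ hf hg, add_comm]
  rfl

theorem dir_smul [NormedSpace ℝ W] {f : V → ℝ} {g : V → W} {x : V} (hf : DifferentiableAt ℝ f x)
    (hg : DifferentiableAt ℝ g x) (v : V) :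
    dir v (fun y => f y • g y) x = dir v f x • g x + f x • dir v g x := by
  simp only [dir]
  erw [fderiv_smul hf hg]
  simp [add_comm]

theorem dir_const [NormedSpace ℝ W] (v : V) (c : W) (x : V) : dir v (fun _ => c) x = 0 := by
  simp [dir]

theorem dir_sum_left [NormedSpace ℝ W] {ι : Type*} (s : Finset ι) (v : ι → V) (f : V → W) (x : V) :
    dir (∑ i ∈ s, v i) f x = ∑ i ∈ s, dir (v i) f x := by simp [dir]

theorem hasDerivAt_line [NormedSpace ℝ W] {f : V → W} {x v : V} {s : ℝ}
    (hf : DifferentiableAt ℝ f (x + s • v)) :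
    HasDerivAt (fun s : ℝ => f (x + s • v)) (dir v f (x + s • v)) s := by
  have h1 : HasDerivAt (fun s : ℝ => x + s • v) v s := by
    simpa using ((hasDerivAt_id s).smul_const v).const_add x
  exact hf.hasFDerivAt.comp_hasDerivAt s h1

theorem hasTwoDeriv_line {f : V → ℝ} (hf : ContDiff ℝ ∞ f) (x v : V) :
    HasTwoDeriv (fun s => f (x + s • v)) (f x) (dir v f x) (dir v (dir v f) x) := by
  refine ⟨by simp, fun s => dir v f (x + s • v), .of_forall fun s =>
    hasDerivAt_line (hf.differentiable (by simp) _), by simp, ?_⟩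
  simpa using hasDerivAt_line (x := x) (v := v) (s := 0)
    ((contDiff_dir hf v).differentiable (by simp) _)

/-- Local data can thus be replaced by globally smooth functions with the same germ, for which
`dir_comm` is an identity of functions and can be used under further derivatives. -/
theorem exists_contDiff_eventuallyEq [NormedSpace ℝ W] [FiniteDimensional ℝ V] {f : V → W} {U : Set V}
    (hU : IsOpen U) (hf : ContDiffOn ℝ ∞ f U) {x : V} (hx : x ∈ U) :
    ∃ g : V → W, ContDiff ℝ ∞ g ∧ g =ᶠ[𝓝 x] f := by
  obtain ⟨r, hr, hrU⟩ := Metric.isOpen_iff.1 hU x hx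
  let χ : ContDiffBump x := ⟨r / 4, r / 2, by positivity, by linarith⟩
  refine ⟨fun y => χ y • f y, contDiff_iff_contDiffAt.2 fun y => ?_, ?_⟩
  · by_cases hy : y ∈ U
    · exact χ.contDiffAt.smul (hf.contDiffAt (hU.mem_nhds hy))
    · have hy' : y ∈ (tsupport χ)ᶜ := fun h => hy <| hrU <| by
        rw [χ.tsupport_eq] at h
        exact Metric.closedBall_subset_ball (by change r / 2 < r; linarith) h
      refine contDiffAt_const.congr_of_eventuallyEq (f := fun _ => (0 : W)) ?_
      filter_upwards [(isClosed_tsupport χ).isOpen_compl.mem_nhds hy'] with z hz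
      rw [image_eq_zero_of_notMem_tsupport hz, zero_smul]
  · filter_upwards [χ.eventuallyEq_one] with y hy
    simp [hy]

end Directional

theorem HasTwoDeriv.rpow_neg_half {f : ℝ → ℝ} {c : ℝ} (hf : HasTwoDeriv f 0 0 c) :
    HasTwoDeriv (fun s => (1 + f s) ^ (-(1 / 2) : ℝ)) 1 0 (-(c / 2)) := by
  have h1 : ∀ p x : ℝ, 0 < 1 + x →
      HasDerivAt (fun x : ℝ => (1 + x) ^ p) (p * (1 + x) ^ (p - 1)) x := by
    intro p x hx
    have := ((hasDerivAt_id x).const_add 1).rpow_const (p := p) (Or.inl hx.ne')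
    simpa using this
  have h2 : ∀ᶠ x : ℝ in 𝓝 0, 0 < 1 + x :=
    (continuous_const.add continuous_id).continuousAt.eventually_const_lt (by simp)
  have := HasTwoDeriv.comp (φ := fun x : ℝ => (1 + x) ^ (-(1 / 2) : ℝ))
    (h2.mono fun x hx => h1 (-(1 / 2)) x hx)
    ((h1 (-(1 / 2) - 1) 0 (by simp)).const_mul (-(1 / 2))) hf
  convert this using 1 <;> simp; ring

/-! ### The time slice: curvature of a graph at a minimum of the principal curvature -/

section Spatial

variable {E ι : Type*} [NormedAddCommGroup E] [InnerProductSpace ℝ E] [Fintype ι]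

/-- The squared length of the gradient of `u`. -/
noncomputable def gradSq (b : OrthonormalBasis ι ℝ E) (u : E → ℝ) (y : E) : ℝ :=
  ∑ i, dir (b i) u y * dir (b i) u y

/-- The factor `(1 + |∇u|²)^{-1/2}`. -/
noncomputable def slope (b : OrthonormalBasis ι ℝ E) (u : E → ℝ) (y : E) : ℝ :=
  (1 + gradSq b u y) ^ (-(1 / 2) : ℝ)

/-- The mean curvature of the graph of `-u`. -/
noncomputable def graphCurvature (b : OrthonormalBasis ι ℝ E) (u : E → ℝ) (y : E) : ℝ :=
  slope b u y * (∑ i, dir (b i) (dir (b i) u) y - slope b u y * slope b u y *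
    ∑ i, ∑ j, dir (b i) u y * (dir (b j) u y * dir (b i) (dir (b j) u) y))

variable {b : OrthonormalBasis ι ℝ E} {u : E → ℝ} {l : ι → ℝ} {lam : ℝ} {e : E}

theorem dir_eq_sum (b : OrthonormalBasis ι ℝ E) (v : E) {W : Type*} [NormedAddCommGroup W]
    [NormedSpace ℝ W] (f : E → W) (x : E) :
    dir v f x = ∑ i, inner ℝ (b i) v • dir (b i) f x := by
  conv_lhs => rw [← b.sum_repr' v]
  simp only [dir_sum_left, dir_smul_left]

/-- Since ∇u vanishes at 0, |∇u|² has zero 1-jet along the line and second derivative 2|Hess u ·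
v|²; the factor -1/2 is the derivative of (1 + x)^(-1/2) at 0. -/
theorem slope_hasTwoDeriv [DecidableEq ι] (hu : ContDiff ℝ ∞ u) (h0 : ∀ i, dir (b i) u 0 = 0)
    (hl : ∀ i j, dir (b i) (dir (b j) u) 0 = if i = j then l i else 0) (v : E) :
    HasTwoDeriv (fun s => slope b u (s • v)) 1 0 (-∑ i, (l i * inner ℝ (b i) v) ^ 2) := by
  have h1 : ∀ i, HasTwoDeriv (fun s => dir (b i) u (s • v)) 0 (l i * inner ℝ (b i) v)
      (dir v (dir v (dir (b i) u)) 0) := by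
    intro i
    have := hasTwoDeriv_line (contDiff_dir hu (b i)) 0 v
    rw [h0, dir_eq_sum b v (dir (b i) u)] at this
    simp only [hl, zero_add] at this
    simpa [mul_comm] using this
  have h2 := HasTwoDeriv.sum Finset.univ (fun i _ => (h1 i).mul (h1 i))
  have h3 := HasTwoDeriv.rpow_neg_half (f := fun s => gradSq b u (s • v))
    (c := ∑ i, 2 * (l i * inner ℝ (b i) v) ^ 2) (by
      convert h2 using 1
      · rfl
      all_goals simp [sq])
  rwa [← Finset.mul_sum, mul_div_cancel_left₀ _ two_ne_zero] at h3

/-- Second order condition for a minimum of the curvature, along a coordinate line. -/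
theorem fourth_deriv_lower_bound [DecidableEq ι] (hu : ContDiff ℝ ∞ u)
    (h0 : ∀ i, dir (b i) u 0 = 0)
    (hl : ∀ i j, dir (b i) (dir (b j) u) 0 = if i = j then l i else 0)
    (hlam : 0 ≤ lam) (hlpos : ∀ i, 0 < l i)
    (hmin : ∀ᶠ y in 𝓝 (0 : E), ∀ v : E,
      lam * (inner ℝ v v + dir v u y * dir v u y) ≤ slope b u y * dir v (dir v u) y)
    (he1 : ‖e‖ = 1) (he : ∀ i, l i * inner ℝ (b i) e = lam * inner ℝ (b i) e) (k : ι) :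
    lam * l k ^ 2 + 2 * lam ^ 3 * (inner ℝ (b k) e) ^ 2 +
      2 * ∑ j, (dir (b k) (dir e (dir (b j) u)) 0) ^ 2 / l j ≤
      dir (b k) (dir (b k) (dir e (dir e u))) 0 := by
  set T : ι → ℝ := fun j => dir (b k) (dir e (dir (b j) u)) 0 with hT
  -- At s • b k the direction e + s • c is tested. The part of the second derivative depending on c
  -- is 4 Σ c_j T_j + 2 Σ (l_j - lam) c_j². The choice c_j = -T_j / l_j minimizes it with lam
  -- dropped: this avoids the denominators l_j - lam, which vanish in the eigenspace of e, and the
  -- neglected term -2 lam |c|² has the right sign.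
  set c : E := ∑ j, (-(T j / l j)) • b j with hc
  have hcj : ∀ j, inner ℝ (b j) c = -(T j / l j) := by
    intro j
    simp [hc, inner_sum, inner_smul_right, b.inner_eq_ite]
  have hdd : ∀ v w : E, dir v (dir w u) 0 = ∑ i, l i * inner ℝ (b i) v * inner ℝ (b i) w := by
    intro v w
    rw [dir_comm hu, dir_eq_sum b w]
    refine Finset.sum_congr rfl fun i _ => ?_
    rw [dir_comm hu, dir_eq_sum b v]
    simp [hl, mul_comm]
  have hu0 : ∀ v, dir v u 0 = 0 := fun v => by rw [dir_eq_sum b v]; simp [h0]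
  have hsum : ∀ v w : E, ∑ i, inner ℝ (b i) v * inner ℝ (b i) w = inner ℝ v w := by
    intro v w
    rw [← b.sum_inner_mul_inner v w]
    exact Finset.sum_congr rfl fun i _ => by rw [real_inner_comm v]
  have hee : inner ℝ e e = (1 : ℝ) := by rw [real_inner_self_eq_norm_sq, he1]; norm_num
  have hde : ∀ v, dir v (dir e u) 0 = lam * inner ℝ v e := by
    intro v
    rw [hdd, ← hsum, Finset.mul_sum]
    refine Finset.sum_congr rfl fun i _ => ?_
    linear_combination (inner ℝ (b i) v) * he i
  have hbk : inner ℝ (b k) (b k) = (1 : ℝ) := by simp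
  have line : ∀ {f : E → ℝ}, ContDiff ℝ ∞ f →
      HasTwoDeriv (fun s : ℝ => f (s • b k)) (f 0) (dir (b k) f 0) (dir (b k) (dir (b k) f) 0) := by
    intro f hf
    simpa using hasTwoDeriv_line hf 0 (b k)
  have jκ := slope_hasTwoDeriv hu h0 hl (b k)
  have jue := line (contDiff_dir hu e)
  have juc := line (contDiff_dir hu c)
  have juee := line (contDiff_dir (contDiff_dir hu e) e)
  have juec := line (contDiff_dir (contDiff_dir hu c) e)
  have jucc := line (contDiff_dir (contDiff_dir hu c) c)
  have hec : dir (b k) (dir e (dir c u)) 0 = -∑ j, T j ^ 2 / l j := by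
    rw [dir_comm hu, dir_comm (contDiff_dir hu e), dir_eq_sum b c, ← Finset.sum_neg_distrib]
    refine Finset.sum_congr rfl fun j _ => ?_
    rw [hcj, dir_comm (contDiff_dir hu e), dir_comm hu (b j)]
    simp only [hT, smul_eq_mul]
    ring
  have hcc : dir c (dir c u) 0 = ∑ j, T j ^ 2 / l j := by
    rw [hdd]
    refine Finset.sum_congr rfl fun j _ => ?_
    rw [hcj]
    field_simp [(hlpos j).ne']
  have jdv := jue.add (HasTwoDeriv.id.mul juc)
  have jddv := (juee.add ((HasTwoDeriv.id.mul juec).const_mul 2)).add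
    ((HasTwoDeriv.id.mul HasTwoDeriv.id).mul jucc)
  have jv : HasTwoDeriv (fun s : ℝ => inner ℝ (e + s • c) (e + s • c))
      1 (2 * inner ℝ e c) (2 * inner ℝ c c) := by
    have := ((HasTwoDeriv.const 1).add (HasTwoDeriv.id.const_mul (2 * inner ℝ e c))).add
      ((HasTwoDeriv.id.mul HasTwoDeriv.id).const_mul (inner ℝ c c))
    convert this using 1
    · funext s
      simp only [inner_add_left, inner_add_right, inner_smul_left, inner_smul_right, hee,
        real_inner_comm e c]
      simp
      ring
    all_goals simp
    ring
  -- The 2-jet of h - lam g on e + s • c at s • b k: zero at s = 0, nonnegative nearby.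
  have jβ := (jκ.mul jddv).sub ((jv.add (jdv.mul jdv)).const_mul lam)
  have hfin := jβ.nonneg_of_isLocalMin <| by
    have ht : Tendsto (fun s : ℝ => s • b k) (𝓝 0) (𝓝 0) := by
      have : Continuous fun s : ℝ => s • b k := by fun_prop
      simpa using this.tendsto 0
    have hz := jβ.1
    rw [hde, hu0, hee] at hz
    filter_upwards [ht.eventually hmin] with s hs
    refine (hz.trans (by ring)).le.trans (sub_nonneg.2 ?_)
    have h1 := hs (e + s • c)
    have h2 : dir (e + s • c) u (s • b k) = dir e u (s • b k) + s * dir c u (s • b k) := by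
      simp [dir_add_left, dir_smul_left]
    have h3 : ∀ x, dir (e + s • c) (dir (e + s • c) u) x = dir e (dir e u) x +
        2 * (s * dir e (dir c u) x) + s * s * dir c (dir c u) x := by
      intro x
      have h4 : ∀ v, dir v (dir (e + s • c) u) x = dir v (dir e u) x + s * dir v (dir c u) x := by
        intro v
        rw [dir_comm hu, dir_add_left, dir_smul_left, dir_comm hu e, dir_comm hu c]
        simp
      rw [dir_add_left, dir_smul_left, h4, h4, dir_comm hu c e, smul_eq_mul]
      ring
    rwa [h2, h3] at h1
  have hk : ∑ i, (l i * inner ℝ (b i) (b k)) ^ 2 = l k ^ 2 := by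
    simp [b.inner_eq_ite]
  rw [hk, hec, hcc, hde e, hee, hde, hu0, hu0] at hfin
  have hcnn : 0 ≤ lam * inner ℝ c c := mul_nonneg hlam real_inner_self_nonneg
  simp only [hT] at hfin ⊢
  linear_combination hfin + 2 * hcnn

/-- The differential inequality for the mean curvature at a minimum of the curvature. -/
theorem graphCurvature_inequality [DecidableEq ι] (hu : ContDiff ℝ ∞ u)
    (h0 : ∀ i, dir (b i) u 0 = 0)
    (hl : ∀ i j, dir (b i) (dir (b j) u) 0 = if i = j then l i else 0)
    (hlam : 0 < lam)
    (hmin : ∀ᶠ y in 𝓝 (0 : E), ∀ v : E,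
      lam * (inner ℝ v v + dir v u y * dir v u y) ≤ slope b u y * dir v (dir v u) y)
    (he1 : ‖e‖ = 1) (he : ∀ i, l i * inner ℝ (b i) e = lam * inner ℝ (b i) e) :
    ∃ H₀ H₁ H₂, HasTwoDeriv (fun s => graphCurvature b u (s • e)) H₀ H₁ H₂ ∧
      lam ≤ H₀ ∧ 2 * H₁ ^ 2 ≤ H₂ * H₀ := by
  have hsl0 : slope b u 0 = 1 := by simp [slope, gradSq, h0]
  have hlk : ∀ k, lam ≤ l k := by
    intro k
    have := hmin.self_of_nhds (b k)
    simpa [hsl0, h0, hl] using this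
  have hlpos : ∀ k, 0 < l k := fun k => hlam.trans_le (hlk k)
  have hF := fourth_deriv_lower_bound hu h0 hl hlam.le hlpos hmin he1 he
  have ha : ∑ i, (inner ℝ (b i) e : ℝ) ^ 2 = 1 := by
    have := b.sum_sq_norm_inner_right e
    simpa [he1] using this
  have hne : (Finset.univ : Finset ι).Nonempty := by
    by_contra h
    rw [Finset.not_nonempty_iff_eq_empty] at h
    simp [h] at ha
  have line : ∀ {f : E → ℝ}, ContDiff ℝ ∞ f →
      HasTwoDeriv (fun s : ℝ => f (s • e)) (f 0) (dir e f 0) (dir e (dir e f) 0) := by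
    intro f hf
    simpa using hasTwoDeriv_line hf 0 e
  have hue : ∀ i, dir e (dir (b i) u) 0 = lam * inner ℝ (b i) e := by
    intro i
    rw [dir_eq_sum b e]
    simp [hl, ← he, mul_comm]
  have jκ := slope_hasTwoDeriv hu h0 hl e
  have hκ : ∑ i, (l i * inner ℝ (b i) e) ^ 2 = lam ^ 2 := by
    simp only [he, mul_pow, ← Finset.mul_sum, ha, mul_one]
  rw [hκ] at jκ
  have jL := HasTwoDeriv.sum Finset.univ fun i _ => line (contDiff_dir (contDiff_dir hu (b i)) (b i))
  have jQ := HasTwoDeriv.sum Finset.univ fun i _ => HasTwoDeriv.sum Finset.univ fun j _ =>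
    (line (contDiff_dir hu (b i))).mul
      ((line (contDiff_dir hu (b j))).mul (line (contDiff_dir (contDiff_dir hu (b j)) (b i))))
  have jH := jκ.mul (jL.sub ((jκ.mul jκ).mul jQ))
  refine ⟨_, _, _, jH, ?_⟩
  set T : ι → ι → ℝ := fun k j => dir (b k) (dir e (dir (b j) u)) 0 with hT
  have hT1 : ∀ i, dir e (dir (b i) (dir (b i) u)) 0 = T i i := fun i => by
    rw [dir_comm (contDiff_dir hu (b i))]
  have hF1 : ∀ i, dir e (dir e (dir (b i) (dir (b i) u))) 0 =
      dir (b i) (dir (b i) (dir e (dir e u))) 0 := fun i => by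
    rw [dir_comm (contDiff_dir hu (b i)) e, dir_comm hu e,
      dir_comm (contDiff_dir (contDiff_dir hu e) (b i)), dir_comm (contDiff_dir hu e) e]
  have hQ2 : ∑ i, 2 * (lam * inner ℝ (b i) e * (lam * inner ℝ (b i) e * l i)) = 2 * lam ^ 3 := by
    have : ∀ i, 2 * (lam * inner ℝ (b i) e * (lam * inner ℝ (b i) e * l i)) =
        2 * lam ^ 3 * (inner ℝ (b i) e) ^ 2 := fun i => by
      linear_combination 2 * lam ^ 2 * inner ℝ (b i) e * he i
    simp only [this, ← Finset.mul_sum, ha, mul_one]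
  -- Cauchy-Schwarz; at 0, Σ l is the mean curvature and Σ T i i its derivative along e.
  have hcs : (∑ i, T i i) ^ 2 ≤ (∑ i, T i i ^ 2 / l i) * ∑ i, l i :=
    Finset.sum_sq_le_sum_mul_sum_of_sq_le_mul _ (fun i _ => div_nonneg (sq_nonneg _) (hlpos i).le)
      (fun i _ => (hlpos i).le) fun i _ => (div_mul_cancel₀ _ (hlpos i).ne').ge
  have hS : 0 < ∑ i, l i := Finset.sum_pos (fun i _ => hlpos i) hne
  have hsumF := Finset.sum_le_sum fun k (_ : k ∈ Finset.univ) => hF k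
  simp only [Finset.sum_add_distrib, ← Finset.mul_sum, ha] at hsumF
  have hdiag : ∑ i, T i i ^ 2 / l i ≤ ∑ k, ∑ j, T k j ^ 2 / l j :=
    Finset.sum_le_sum fun k _ => Finset.single_le_sum (f := fun j => T k j ^ 2 / l j)
      (fun j _ => div_nonneg (sq_nonneg _) (hlpos j).le) (Finset.mem_univ k)
  -- Multiplied by lam, this absorbs the term -lam² Σ l coming from the second derivative of
  -- `slope`. The 2 lam³ in the sum of `hF` cancels the one in `hQ2`.
  have hll : lam * ∑ k, l k ≤ ∑ k, l k ^ 2 := by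
    rw [Finset.mul_sum]
    exact Finset.sum_le_sum fun k _ => by nlinarith [hlk k, hlpos k]
  have hll' := mul_le_mul_of_nonneg_left hll hlam.le
  simp only [hl, h0, hue, hT1, hF1, if_true, zero_mul, mul_zero, zero_add, add_zero,
    Finset.sum_const_zero, sub_zero, one_mul, mul_one, mul_ite, Finset.sum_ite_eq, ite_self, hQ2,
    Finset.mem_univ]
  have hlS : lam ≤ ∑ i, l i := by
    obtain ⟨i, hi⟩ := hne
    exact (hlk i).trans (Finset.single_le_sum (fun j _ => (hlpos j).le) hi)
  refine ⟨hlS, ?_⟩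
  rw [mul_one] at hsumF
  calc 2 * (∑ i, T i i) ^ 2 ≤ 2 * ((∑ i, T i i ^ 2 / l i) * ∑ i, l i) := by linarith
    _ = (2 * ∑ i, T i i ^ 2 / l i) * ∑ i, l i := by ring
    _ ≤ _ := mul_le_mul_of_nonneg_right (by linarith) hS.le

end Spatial

theorem diffAt {V W : Type*} [NormedAddCommGroup V] [NormedSpace ℝ V] [NormedAddCommGroup W]
    [NormedSpace ℝ W] {f : V → W} (hf : ContDiff ℝ ∞ f) (x : V) : DifferentiableAt ℝ f x :=
  hf.differentiable (by simp) x

/-! ### Evolution of the first and second fundamental forms -/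

section Evolution

variable {V A : Type*} [NormedAddCommGroup V] [NormedSpace ℝ V] [NormedAddCommGroup A]
  [InnerProductSpace ℝ A] {F N : V → A} {Ψ : V → ℝ} {q e τ : V}

/-- Evolution of the metric coefficient `⟨∂_e F, ∂_e F⟩` under `∂_τ F = -Ψ N`. -/
theorem dir_metric (hF : ContDiff ℝ ∞ F) (hN : ContDiff ℝ ∞ N) (hΨ : ContDiff ℝ ∞ Ψ)
    (hFt : ∀ᶠ x in 𝓝 q, dir τ F x = -(Ψ x) • N x)
    (hNF : ∀ᶠ x in 𝓝 q, inner ℝ (N x) (dir e F x) = 0) :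
    dir τ (fun x => inner ℝ (dir e F x) (dir e F x)) q =
      -2 * Ψ q * inner ℝ (dir e N q) (dir e F q) := by
  have h1 : dir τ (dir e F) q = -(dir e Ψ q) • N q - Ψ q • dir e N q := by
    rw [dir_comm hF, (dir_congr hFt e).self_of_nhds, dir_smul (diffAt hΨ.neg q) (diffAt hN q)]
    simp [dir, sub_eq_add_neg]
  rw [dir_inner (diffAt (contDiff_dir hF e) q) (diffAt (contDiff_dir hF e) q), h1,
    real_inner_comm _ (dir e F q)]
  simp only [inner_sub_left, inner_smul_left, hNF.self_of_nhds]
  simp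
  ring

/-- Evolution of the second fundamental form coefficient `⟨∂_e N, ∂_e F⟩` under
`∂_τ F = -Ψ N`, at a point where `∂_e ∂_e F` is normal. -/
theorem dir_secondForm (hF : ContDiff ℝ ∞ F) (hN : ContDiff ℝ ∞ N) (hΨ : ContDiff ℝ ∞ Ψ)
    (hFt : ∀ᶠ x in 𝓝 q, dir τ F x = -(Ψ x) • N x)
    (hNN : ∀ᶠ x in 𝓝 q, inner ℝ (N x) (N x) = (1 : ℝ))
    (hNF : ∀ᶠ x in 𝓝 q, inner ℝ (N x) (dir e F x) = 0) {c : ℝ}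
    (hFee : dir e (dir e F) q = c • N q) :
    dir τ (fun x => inner ℝ (dir e N x) (dir e F x)) q =
      dir e (dir e Ψ) q - Ψ q * inner ℝ (dir e N q) (dir e N q) := by
  have hNN' : ∀ v, ∀ᶠ x in 𝓝 q, inner ℝ (N x) (dir v N x) = 0 := by
    intro v
    have : (fun x => (inner ℝ (N x) (N x) : ℝ)) =ᶠ[𝓝 q] fun _ => 1 := hNN
    filter_upwards [dir_congr this v] with x hx
    rw [dir_inner (diffAt hN x) (diffAt hN x), dir_const, real_inner_comm] at hx
    linarith
  have hNee : inner ℝ (N q) (dir e (dir e N) q) = -inner ℝ (dir e N q) (dir e N q) := by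
    have h0 : (fun x => (inner ℝ (N x) (dir e N x) : ℝ)) =ᶠ[𝓝 q] fun _ => 0 := hNN' e
    have := (dir_congr h0 e).self_of_nhds
    rw [dir_inner (diffAt hN q) (diffAt (contDiff_dir hN e) q), dir_const] at this
    linarith
  have hh : (fun x => (inner ℝ (dir e N x) (dir e F x) : ℝ)) =ᶠ[𝓝 q]
      fun x => -inner ℝ (N x) (dir e (dir e F) x) := by
    have h0 : (fun x => (inner ℝ (N x) (dir e F x) : ℝ)) =ᶠ[𝓝 q] fun _ => 0 := hNF
    filter_upwards [dir_congr h0 e] with x hx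
    rw [dir_inner (diffAt hN x) (diffAt (contDiff_dir hF e) x), dir_const] at hx
    linarith
  have h1 : dir τ (dir e (dir e F)) q =
      -(dir e (dir e Ψ) q • N q + (2 * dir e Ψ q) • dir e N q + Ψ q • dir e (dir e N) q) := by
    rw [dir_comm (contDiff_dir hF e), dir_comm hF]
    have h2 : dir e (dir τ F) =ᶠ[𝓝 q] fun x => (-dir e Ψ x) • N x + (-Ψ x) • dir e N x := by
      filter_upwards [dir_congr hFt e] with x hx
      rw [hx, dir_smul (diffAt hΨ.neg x) (diffAt hN x)]
      simp [dir]
    have h3 := diffAt ((contDiff_dir hΨ e).neg.smul hN) q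
    have h4 := diffAt (hΨ.neg.smul (contDiff_dir hN e)) q
    have hadd : dir e (fun x => (-dir e Ψ x) • N x + (-Ψ x) • dir e N x) q =
        dir e (fun x => (-dir e Ψ x) • N x) q + dir e (fun x => (-Ψ x) • dir e N x) q := by
      simp only [dir] at h3 h4 ⊢
      erw [fderiv_add h3 h4]
      rfl
    rw [(dir_congr h2 e).self_of_nhds, hadd, dir_smul (diffAt (contDiff_dir hΨ e).neg q) (diffAt hN q),
      dir_smul (diffAt hΨ.neg q) (diffAt (contDiff_dir hN e) q)]
    have hneg : ∀ f : V → ℝ, dir e (fun x => -f x) q = -dir e f q := fun f => by simp [dir]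
    rw [hneg, hneg]
    module
  have hneg : dir τ (fun x => -(inner ℝ (N x) (dir e (dir e F) x) : ℝ)) q =
      -dir τ (fun x => (inner ℝ (N x) (dir e (dir e F) x) : ℝ)) q := by simp [dir]
  -- Differentiating -⟨N, ∂_e ∂_e F⟩, the term with ∂_τ N drops out because ∂_e ∂_e F is a multiple
  -- of N and ∂_τ N is orthogonal to N; so the evolution of N is not needed.
  rw [(dir_congr hh τ).self_of_nhds, hneg,
    dir_inner (diffAt hN q) (diffAt (contDiff_dir (contDiff_dir hF e) e) q), h1, hFee]
  simp only [inner_neg_right, inner_add_right, inner_smul_right, hNN.self_of_nhds,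
    (hNN' e).self_of_nhds, hNee, real_inner_comm (N q) (dir τ N q), (hNN' τ).self_of_nhds]
  ring

end Evolution

/-! ### Linear algebra of the Weingarten map -/

section Linear

variable {n : ℕ} {A : Type*} [NormedAddCommGroup A] [InnerProductSpace ℝ A]

local notation "E" => EuclideanSpace ℝ (Fin n)

/-- The matrix of inner products of the images of the standard basis under two linear maps. -/
noncomputable def gram (b a : E →L[ℝ] A) : Matrix (Fin n) (Fin n) ℝ :=
  Matrix.of fun i j => inner ℝ (b (EuclideanSpace.single i 1)) (a (EuclideanSpace.single j 1))

theorem apply_eq_sum_single (a : E →L[ℝ] A) (v : E) :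
    a v = ∑ i, v i • a (EuclideanSpace.single i 1) := by
  conv_lhs => rw [← (EuclideanSpace.basisFun (Fin n) ℝ).sum_repr v]
  simp

theorem gram_mulVec (b a : E →L[ℝ] A) (v : E) (i : Fin n) :
    (gram b a).mulVec v.ofLp i = inner ℝ (b (EuclideanSpace.single i 1)) (a v) := by
  rw [apply_eq_sum_single a v, inner_sum]
  simp [Matrix.mulVec, dotProduct, gram, inner_smul_right, mul_comm]

theorem det_gram_ne_zero {a : E →L[ℝ] A} (ha : Function.Injective a) : (gram a a).det ≠ 0 := by
  intro h
  obtain ⟨v, hv, h0⟩ := Matrix.exists_mulVec_eq_zero_iff.2 h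
  refine hv ?_
  have h1 : inner ℝ (a (WithLp.toLp 2 v)) (a (WithLp.toLp 2 v)) = (0 : ℝ) := by
    conv_lhs => arg 2; rw [apply_eq_sum_single a]
    rw [sum_inner]
    refine Finset.sum_eq_zero fun i _ => ?_
    rw [inner_smul_left, ← gram_mulVec, h0]
    simp
  have h2 : WithLp.toLp 2 v = (0 : E) := ha (by rw [inner_self_eq_zero.1 h1, map_zero])
  simpa using congrArg WithLp.ofLp h2

/-- Multiplying by the Gram matrix gives the generalized eigenvalue equation h v = κ g v, which is
free of coordinates. -/
theorem hasEigenvalue_iff {a b : E →L[ℝ] A} (ha : Function.Injective a) (κ : ℝ) :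
    Module.End.HasEigenvalue (Matrix.toLin' ((gram a a)⁻¹ * gram b a)) κ ↔
      ∃ v : E, v ≠ 0 ∧ ∀ w, inner ℝ (b w) (a v) = κ * inner ℝ (a w) (a v) := by
  have hdet : IsUnit (gram a a).det := (det_gram_ne_zero ha).isUnit
  have key : ∀ v : E, ((gram a a)⁻¹ * gram b a).mulVec v.ofLp = κ • v.ofLp ↔
      ∀ w, inner ℝ (b w) (a v) = κ * inner ℝ (a w) (a v) := by
    intro v
    have h1 : ((gram a a)⁻¹ * gram b a).mulVec v.ofLp = κ • v.ofLp ↔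
        (gram b a).mulVec v.ofLp = κ • (gram a a).mulVec v.ofLp := by
      constructor
      · intro h
        rw [← Matrix.mulVec_smul, ← h, Matrix.mulVec_mulVec, ← mul_assoc,
          Matrix.mul_nonsing_inv _ hdet, one_mul]
      · intro h
        rw [← Matrix.mulVec_mulVec, h, Matrix.mulVec_smul, Matrix.mulVec_mulVec,
          Matrix.nonsing_inv_mul _ hdet, Matrix.one_mulVec]
    rw [h1]
    constructor
    · intro h w
      rw [apply_eq_sum_single b w, apply_eq_sum_single a w, sum_inner, sum_inner, Finset.mul_sum]
      refine Finset.sum_congr rfl fun i _ => ?_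
      have := congrFun h i
      rw [Pi.smul_apply, gram_mulVec, gram_mulVec, smul_eq_mul] at this
      rw [inner_smul_left, inner_smul_left, this]
      ring
    · intro h
      funext i
      rw [Pi.smul_apply, gram_mulVec, gram_mulVec, h, smul_eq_mul]
  constructor
  · intro h
    obtain ⟨v, hv⟩ := h.exists_hasEigenvector
    refine ⟨WithLp.toLp 2 v, by simpa using hv.2, (key _).1 ?_⟩
    simpa using hv.apply_eq_smul
  · rintro ⟨v, hv, h⟩
    refine Module.End.hasEigenvalue_of_hasEigenvector (x := v.ofLp) ⟨?_, by simpa using hv⟩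
    rw [Module.End.mem_eigenspace_iff, Matrix.toLin'_apply]
    exact (key v).2 h

/-- For small s of sign opposite to x the linear term dominates; s = -x / (y + 1) is small enough,
where s = ±1 shows y ≥ 0. -/
theorem eq_zero_of_linear_quadratic {x y : ℝ} (h : ∀ s : ℝ, 0 ≤ 2 * s * x + s ^ 2 * y) :
    x = 0 := by
  by_contra hx
  have hy : 0 ≤ y := by have := h 1; have := h (-1); linarith
  have h1 := h (-x / (y + 1))
  have h2 : 2 * (-x / (y + 1)) * x + (-x / (y + 1)) ^ 2 * y = -(x ^ 2 * (y + 2)) / (y + 1) ^ 2 := by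
    field_simp
    ring
  rw [h2] at h1
  have : 0 < x ^ 2 * (y + 2) / (y + 1) ^ 2 := by positivity
  rw [neg_div] at h1
  linarith

/-- If `h - κ g` is positive semidefinite and vanishes in the direction `v`, then `v` is an
eigenvector. -/
theorem eigenvector_of_min {E' : Type*} [NormedAddCommGroup E'] [NormedSpace ℝ E']
    {a b : E' →L[ℝ] A}
    (hs : ∀ v w, inner ℝ (b v) (a w) = (inner ℝ (b w) (a v) : ℝ)) {κ : ℝ} {v : E'}
    (hle : ∀ w, κ * inner ℝ (a w) (a w) ≤ inner ℝ (b w) (a w))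
    (hv : inner ℝ (b v) (a v) = κ * inner ℝ (a v) (a v)) (w : E') :
    inner ℝ (b w) (a v) = κ * inner ℝ (a w) (a v) := by
  -- On v + s • w the form h - κ g has no constant term in s, so its linear coefficient must vanish.
  refine sub_eq_zero.1 (eq_zero_of_linear_quadratic
    (y := inner ℝ (b w) (a w) - κ * inner ℝ (a w) (a w)) fun s => ?_)
  have h := hle (v + s • w)
  simp only [map_add, map_smul, inner_add_left, inner_add_right, inner_smul_left,
    inner_smul_right, hs v w, hv, real_inner_comm (a w) (a v)] at h
  simp only [conj_trivial] at h
  linarith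

/-- Existence of a smallest principal curvature. -/
theorem exists_min_eigenvector (hn : 0 < n) {a b : E →L[ℝ] A} (ha : Function.Injective a)
    (hs : ∀ v w, inner ℝ (b v) (a w) = (inner ℝ (b w) (a v) : ℝ)) :
    ∃ κ : ℝ, (∀ w, κ * inner ℝ (a w) (a w) ≤ inner ℝ (b w) (a w)) ∧
      ∃ v : E, v ≠ 0 ∧ ∀ w, inner ℝ (b w) (a v) = κ * inner ℝ (a w) (a v) := by
  have hpos : ∀ v : E, v ≠ 0 → (0 : ℝ) < inner ℝ (a v) (a v) := fun v hv =>
    real_inner_self_pos.2 fun h => hv (ha (by rw [h, map_zero]))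
  have : Nonempty (Fin n) := ⟨⟨0, hn⟩⟩
  have hne : (Metric.sphere (0 : E) 1).Nonempty := NormedSpace.sphere_nonempty.2 zero_le_one
  have hsph : ∀ v ∈ Metric.sphere (0 : E) 1, v ≠ 0 := fun v hv h => by simp [h] at hv
  -- The minimizer of the Rayleigh quotient on the unit sphere is the required eigenvector.
  obtain ⟨v, hv, hmin⟩ := (isCompact_sphere (0 : E) 1).exists_isMinOn hne
    (f := fun v => (inner ℝ (b v) (a v) / inner ℝ (a v) (a v) : ℝ))
    (ContinuousOn.div (by fun_prop) (by fun_prop) fun v hv => (hpos v (hsph v hv)).ne')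
  have hle : ∀ w, (inner ℝ (b v) (a v) / inner ℝ (a v) (a v) : ℝ) * inner ℝ (a w) (a w) ≤
      inner ℝ (b w) (a w) := by
    intro w
    by_cases hw : w = 0
    · simp [hw]
    have hm := hmin (show ‖w‖⁻¹ • w ∈ Metric.sphere (0 : E) 1 by simp [norm_smul, hw])
    rw [← le_div_iff₀ (hpos w hw)]
    refine hm.trans (le_of_eq ?_)
    have : ‖w‖⁻¹ ≠ 0 := by simpa using hw
    simp only [map_smul, inner_smul_left, inner_smul_right, conj_trivial]
    field_simp
  refine ⟨_, hle, v, hsph v hv, eigenvector_of_min hs hle ?_⟩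
  rw [div_mul_cancel₀ _ (hpos v (hsph v hv)).ne']

theorem gram_comp (b a : E →L[ℝ] A) (J : E →L[ℝ] E) :
    gram (b.comp J) (a.comp J) =
      (Matrix.of fun i j => J (EuclideanSpace.single j 1) i).transpose * gram b a *
        Matrix.of fun i j => J (EuclideanSpace.single j 1) i := by
  ext i j
  simp only [gram, Matrix.mul_apply, Matrix.of_apply, Matrix.transpose_apply,
    ContinuousLinearMap.comp_apply]
  rw [apply_eq_sum_single a (J _), apply_eq_sum_single b (J _), inner_sum]
  refine Finset.sum_congr rfl fun k _ => ?_
  rw [sum_inner, Finset.sum_mul]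
  refine Finset.sum_congr rfl fun m _ => ?_
  rw [inner_smul_left, inner_smul_right]
  simp
  ring

/-- The trace of the Weingarten map does not depend on the coordinates. -/
theorem trace_gram_comp (b a : E →L[ℝ] A) (J : E →L[ℝ] E) (hJ : Function.Injective J) :
    ((gram (a.comp J) (a.comp J))⁻¹ * gram (b.comp J) (a.comp J)).trace =
      ((gram a a)⁻¹ * gram b a).trace := by
  rw [gram_comp, gram_comp]
  set P : Matrix (Fin n) (Fin n) ℝ := Matrix.of fun i j => J (EuclideanSpace.single j 1) i with hP
  have hdet : IsUnit P.det := by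
    refine isUnit_iff_ne_zero.2 fun h => ?_
    obtain ⟨v, hv, h0⟩ := Matrix.exists_mulVec_eq_zero_iff.2 h
    have : J (WithLp.toLp 2 v) = 0 := by
      rw [apply_eq_sum_single J]
      ext i
      simpa [Matrix.mulVec, dotProduct, hP, mul_comm] using congrFun h0 i
    have h2 : WithLp.toLp 2 v = (0 : E) := hJ (by rw [this, map_zero])
    exact hv (by simpa using congrArg WithLp.ofLp h2)
  have hdetT : IsUnit P.transpose.det := by rwa [Matrix.det_transpose]
  -- With g, h the Gram matrices and P the matrix of J, the product is P⁻¹ g⁻¹ h P.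
  rw [Matrix.mul_inv_rev, Matrix.mul_inv_rev, Matrix.trace_mul_comm]
  have : P.transpose * gram b a * P * (P⁻¹ * ((gram a a)⁻¹ * P.transpose⁻¹)) =
      P.transpose * (gram b a * ((gram a a)⁻¹ * P.transpose⁻¹)) := by
    simp only [Matrix.mul_assoc, Matrix.mul_nonsing_inv_cancel_left _ _ hdet]
  rw [this, Matrix.trace_mul_comm, Matrix.mul_assoc, Matrix.mul_assoc,
    Matrix.nonsing_inv_mul _ hdetT, mul_one, Matrix.trace_mul_comm]

end Linear

/-! ### The flow in a coordinate patch -/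

section LocalFlow

variable {n : ℕ}

local notation "E" => EuclideanSpace ℝ (Fin n)

/-- The derivative of `Y(·, t)` at `y`. -/
noncomputable def spaceDeriv (Y : E × ℝ → Ambient n) (t : ℝ) (y : E) : E →L[ℝ] Ambient n :=
  fderiv ℝ (fun z => Y (z, t)) y

/-- The mean curvature of `Y(·, t)` with unit normal `N(·, t)` at `y`. -/
noncomputable def localCurvature (Y N : E × ℝ → Ambient n) (t : ℝ) (y : E) : ℝ :=
  ((gram (spaceDeriv Y t y) (spaceDeriv Y t y))⁻¹ *
    gram (spaceDeriv N t y) (spaceDeriv Y t y)).trace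

/-- The `Φ(H)`-flow in a coordinate patch `U`. -/
structure IsLocalFlow (Φ : ℝ → ℝ) (T : ℝ) (U : Set E) (Y N : E × ℝ → Ambient n) : Prop where
  isOpen : IsOpen U
  smooth : ContDiffOn ℝ ∞ Y (U ×ˢ Ico 0 T)
  smooth_normal : ContDiffOn ℝ ∞ N (U ×ˢ Ico 0 T)
  injective : ∀ t ∈ Ico 0 T, ∀ y ∈ U, Function.Injective (spaceDeriv Y t y)
  norm_normal : ∀ t ∈ Ico 0 T, ∀ y ∈ U, ‖N (y, t)‖ = 1
  inner_normal : ∀ t ∈ Ico 0 T, ∀ y ∈ U, ∀ v, inner ℝ (N (y, t)) (spaceDeriv Y t y v) = 0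
  evolution : ∀ t ∈ Ico 0 T, ∀ y ∈ U, HasDerivWithinAt (fun s => Y (y, s))
    (-(Φ (localCurvature Y N t y)) • N (y, t)) (Ico 0 T) t

variable {Φ : ℝ → ℝ} {T t : ℝ} {U : Set (EuclideanSpace ℝ (Fin n))}
  {Y N : EuclideanSpace ℝ (Fin n) × ℝ → Ambient n} {y : EuclideanSpace ℝ (Fin n)}

theorem contDiffOn_slice {W : Type*} [NormedAddCommGroup W] [NormedSpace ℝ W] {F : E × ℝ → W}
    (hF : ContDiffOn ℝ ∞ F (U ×ˢ Ico 0 T)) (ht : t ∈ Ico 0 T) :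
    ContDiffOn ℝ ∞ (fun z => F (z, t)) U :=
  hF.comp (contDiff_id.prodMk contDiff_const).contDiffOn fun _ hz => ⟨hz, ht⟩

/-- The time interval is one-sided at 0, so joint smoothness only controls derivatives within U ×
[0, T); their restriction to space is the ordinary derivative because U is open. -/
theorem spaceDeriv_eq (hU : IsOpen U) (hY : ContDiffOn ℝ ∞ Y (U ×ˢ Ico 0 T)) (ht : t ∈ Ico 0 T)
    (hy : y ∈ U) : spaceDeriv Y t y =
      (fderivWithin ℝ Y (U ×ˢ Ico 0 T) (y, t)).comp (ContinuousLinearMap.inl ℝ E ℝ) := by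
  have h1 := (hY.differentiableOn (by simp) (y, t) ⟨hy, ht⟩).hasFDerivWithinAt
  have h2 : HasFDerivWithinAt (fun z : E => (z, t)) (ContinuousLinearMap.inl ℝ E ℝ) U y :=
    (hasFDerivAt_prodMk_left y t).hasFDerivWithinAt
  have h3 := HasFDerivWithinAt.comp (t := U ×ˢ Ico 0 T) y h1 h2 fun z hz => ⟨hz, ht⟩
  exact (h3.hasFDerivAt (hU.mem_nhds hy)).fderiv

theorem continuousOn_spaceDeriv (hU : IsOpen U) (hY : ContDiffOn ℝ ∞ Y (U ×ˢ Ico 0 T)) :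
    ContinuousOn (fun q : E × ℝ => spaceDeriv Y q.2 q.1) (U ×ˢ Ico 0 T) := by
  have h := hY.continuousOn_fderivWithin (hU.uniqueDiffOn.prod (uniqueDiffOn_Ico 0 T))
    (one_le_two.trans two_le_infty)
  exact (h.clm_comp continuousOn_const).congr fun q hq => spaceDeriv_eq hU hY hq.2 hq.1

namespace IsLocalFlow

/-- Obtained by differentiating ⟨N, ∂_w Y⟩ = 0 in the direction v; symmetry of h follows from it. -/
theorem secondForm_eq_neg (hf : IsLocalFlow Φ T U Y N) (ht : t ∈ Ico 0 T) (hy : y ∈ U)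
    {f : EuclideanSpace ℝ (Fin n) → Ambient n} (hfs : ContDiff ℝ ∞ f)
    (hfe : f =ᶠ[𝓝 y] fun z => Y (z, t)) (v w : EuclideanSpace ℝ (Fin n)) :
    (inner ℝ (spaceDeriv N t y v) (spaceDeriv Y t y w) : ℝ) =
      -inner ℝ (N (y, t)) (dir v (dir w f) y) := by
  obtain ⟨g, hgs, hge⟩ :=
    exists_contDiff_eventuallyEq hf.isOpen (contDiffOn_slice hf.smooth_normal ht) hy
  have h0 : (fun z => (inner ℝ (g z) (dir w f z) : ℝ)) =ᶠ[𝓝 y] fun _ => 0 := by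
    filter_upwards [hge, dir_congr hfe w, hf.isOpen.mem_nhds hy] with z h1 h2 h3
    rw [h1, h2]
    exact hf.inner_normal t ht z h3 w
  have h1 := (dir_congr h0 v).self_of_nhds
  rw [dir_inner (diffAt hgs y) (diffAt (contDiff_dir hfs w) y), dir_const,
    (dir_congr hge v).self_of_nhds, (dir_congr hfe w).self_of_nhds, hge.self_of_nhds] at h1
  exact eq_neg_of_add_eq_zero_left h1

theorem symm (hf : IsLocalFlow Φ T U Y N) (ht : t ∈ Ico 0 T) (hy : y ∈ U) (v w : E) :
    inner ℝ (spaceDeriv N t y v) (spaceDeriv Y t y w) =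
      (inner ℝ (spaceDeriv N t y w) (spaceDeriv Y t y v) : ℝ) := by
  obtain ⟨f, hfs, hfe⟩ := exists_contDiff_eventuallyEq hf.isOpen (contDiffOn_slice hf.smooth ht) hy
  rw [hf.secondForm_eq_neg ht hy hfs hfe, hf.secondForm_eq_neg ht hy hfs hfe, dir_comm hfs]

/-- Positivity of `h - c g` is an open condition. -/
theorem eventually_pos (hf : IsLocalFlow Φ T U Y N) (ht : t ∈ Ico 0 T) (hy : y ∈ U) {c : ℝ}
    (hc : ∀ v, v ≠ 0 → c * inner ℝ (spaceDeriv Y t y v) (spaceDeriv Y t y v) <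
      inner ℝ (spaceDeriv N t y v) (spaceDeriv Y t y v)) :
    ∀ᶠ q in 𝓝[U ×ˢ Ico 0 T] (y, t), ∀ v, v ≠ 0 →
      c * inner ℝ (spaceDeriv Y q.2 q.1 v) (spaceDeriv Y q.2 q.1 v) <
        inner ℝ (spaceDeriv N q.2 q.1 v) (spaceDeriv Y q.2 q.1 v) := by
  have hY := continuousOn_spaceDeriv hf.isOpen hf.smooth (y, t) ⟨hy, ht⟩
  have hN := continuousOn_spaceDeriv hf.isOpen hf.smooth_normal (y, t) ⟨hy, ht⟩
  -- By homogeneity unit directions suffice, and compactness of the sphere makes the condition open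
  -- in the pair of linear maps.
  set S : Set ((E →L[ℝ] Ambient n) × (E →L[ℝ] Ambient n)) :=
    {p | ∀ v ∈ Metric.sphere (0 : E) 1, c * inner ℝ (p.2 v) (p.2 v) < inner ℝ (p.1 v) (p.2 v)}
  have hS : ∀ᶠ p in 𝓝 (spaceDeriv N t y, spaceDeriv Y t y), p ∈ S := by
    refine (isCompact_sphere (0 : E) 1).eventually_forall_of_forall_eventually fun v hv => ?_
    have h1 : Continuous fun z : ((E →L[ℝ] Ambient n) × (E →L[ℝ] Ambient n)) × E =>
        c * (inner ℝ (z.1.2 z.2) (z.1.2 z.2) : ℝ) := by fun_prop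
    have h2 : Continuous fun z : ((E →L[ℝ] Ambient n) × (E →L[ℝ] Ambient n)) × E =>
        (inner ℝ (z.1.1 z.2) (z.1.2 z.2) : ℝ) := by fun_prop
    exact h1.continuousAt.eventually_lt h2.continuousAt
      (hc v fun h => by simp [h] at hv)
  filter_upwards [(hN.prodMk hY).eventually hS] with q hq v hv
  have h := hq (‖v‖⁻¹ • v) (by simp [norm_smul, hv])
  simp only [map_smul, inner_smul_left, inner_smul_right, conj_trivial] at h
  have h0 : 0 < ‖v‖⁻¹ * ‖v‖⁻¹ := by positivity
  refine lt_of_mul_lt_mul_left ?_ h0.le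
  linarith

theorem continuousOn_localCurvature (hf : IsLocalFlow Φ T U Y N) :
    ContinuousOn (fun q : E × ℝ => localCurvature Y N q.2 q.1) (U ×ˢ Ico 0 T) := by
  have hY := continuousOn_spaceDeriv hf.isOpen hf.smooth
  have hN := continuousOn_spaceDeriv hf.isOpen hf.smooth_normal
  have hgram : ∀ {b a : E × ℝ → E →L[ℝ] Ambient n}, ContinuousOn b (U ×ˢ Ico 0 T) →
      ContinuousOn a (U ×ˢ Ico 0 T) → ContinuousOn (fun q => gram (b q) (a q)) (U ×ˢ Ico 0 T) := by
    intro b a hb ha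
    refine continuousOn_pi.2 fun i => continuousOn_pi.2 fun j => ?_
    exact (hb.clm_apply continuousOn_const).inner (𝕜 := ℝ) (ha.clm_apply continuousOn_const)
  have hG := hgram hY hY
  have hinv : ContinuousOn (fun q : E × ℝ =>
      (gram (spaceDeriv Y q.2 q.1) (spaceDeriv Y q.2 q.1))⁻¹) (U ×ˢ Ico 0 T) := by
    simp only [Matrix.inv_def, Ring.inverse_eq_inv']
    refine ContinuousOn.smul (ContinuousOn.inv₀ ?_ fun q hq =>
      det_gram_ne_zero (hf.injective q.2 hq.2 q.1 hq.1)) ?_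
    · exact (Continuous.matrix_det continuous_id).comp_continuousOn hG
    · exact (Continuous.matrix_adjugate continuous_id).comp_continuousOn hG
  have hmul : ContinuousOn (fun q : E × ℝ =>
      (gram (spaceDeriv Y q.2 q.1) (spaceDeriv Y q.2 q.1))⁻¹ *
        gram (spaceDeriv N q.2 q.1) (spaceDeriv Y q.2 q.1)) (U ×ˢ Ico 0 T) :=
    hinv.mul (hgram hN hY)
  exact (Continuous.matrix_trace continuous_id).comp_continuousOn hmul

/-- Pulling back a local flow along a change of coordinates. -/
theorem comp (hf : IsLocalFlow Φ T U Y N) {V : Set E} (hV : IsOpen V) {ψ : E → E}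
    (hψ : ContDiffOn ℝ ∞ ψ V) (hmaps : MapsTo ψ V U)
    (hinj : ∀ y ∈ V, Function.Injective (fderiv ℝ ψ y)) :
    IsLocalFlow Φ T V (fun q => Y (ψ q.1, q.2)) (fun q => N (ψ q.1, q.2)) ∧
    ∀ t ∈ Ico 0 T, ∀ y ∈ V,
      spaceDeriv (fun q => Y (ψ q.1, q.2)) t y = (spaceDeriv Y t (ψ y)).comp (fderiv ℝ ψ y) ∧
      spaceDeriv (fun q => N (ψ q.1, q.2)) t y = (spaceDeriv N t (ψ y)).comp (fderiv ℝ ψ y) := by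
  have hd : ∀ {F : E × ℝ → Ambient n}, ContDiffOn ℝ ∞ F (U ×ˢ Ico 0 T) → ∀ t ∈ Ico 0 T, ∀ y ∈ V,
      spaceDeriv (fun q => F (ψ q.1, q.2)) t y = (spaceDeriv F t (ψ y)).comp (fderiv ℝ ψ y) := by
    intro F hF t ht y hy
    have h1 := ((contDiffOn_slice hF ht).contDiffAt
      (hf.isOpen.mem_nhds (hmaps hy))).differentiableAt (by simp)
    have h2 := (hψ.contDiffAt (hV.mem_nhds hy)).differentiableAt (by simp)
    exact fderiv_comp y h1 h2
  have hs : ∀ {F : E × ℝ → Ambient n}, ContDiffOn ℝ ∞ F (U ×ˢ Ico 0 T) →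
      ContDiffOn ℝ ∞ (fun q : E × ℝ => F (ψ q.1, q.2)) (V ×ˢ Ico 0 T) := fun hF =>
    hF.comp ((hψ.comp contDiffOn_fst fun q hq => hq.1).prodMk contDiffOn_snd)
      fun q hq => ⟨hmaps hq.1, hq.2⟩
  refine ⟨⟨hV, hs hf.smooth, hs hf.smooth_normal, ?_,
    fun t ht y hy => hf.norm_normal t ht _ (hmaps hy), ?_, ?_⟩,
    fun t ht y hy => ⟨hd hf.smooth t ht y hy, hd hf.smooth_normal t ht y hy⟩⟩
  · intro t ht y hy
    rw [hd hf.smooth t ht y hy]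
    exact (hf.injective t ht _ (hmaps hy)).comp (hinj y hy)
  · intro t ht y hy v
    rw [hd hf.smooth t ht y hy]
    exact hf.inner_normal t ht _ (hmaps hy) _
  · intro t ht y hy
    have h := hf.evolution t ht _ (hmaps hy)
    have hH : localCurvature (fun q => Y (ψ q.1, q.2)) (fun q => N (ψ q.1, q.2)) t y =
        localCurvature Y N t (ψ y) := by
      rw [localCurvature, hd hf.smooth t ht y hy, hd hf.smooth_normal t ht y hy,
        trace_gram_comp _ _ _ (hinj y hy)]
      rfl
    rwa [hH]

end IsLocalFlow

end LocalFlow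

/-! ### From the manifold to coordinate patches -/

section Chart

variable {n : ℕ} {M : Type*} [TopologicalSpace M] [ChartedSpace (EuclideanSpace ℝ (Fin n)) M]

local notation "E" => EuclideanSpace ℝ (Fin n)

/-- The derivative of `F : M → ℝ^{n+1}` at `p`, in the preferred chart at `p`. -/
noncomputable def tangentMap (F : M → Ambient n) (p : M) : E →L[ℝ] Ambient n :=
  mfderiv (𝓡 n) 𝓘(ℝ, Ambient n) F p

variable {Φ : ℝ → ℝ} {T : ℝ} {X ν : ℝ → M → Ambient n}

theorem contMDiff_slice {F : ℝ → M → Ambient n}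
    (hF : ContMDiffOn ((𝓡 n).prod 𝓘(ℝ, ℝ)) 𝓘(ℝ, Ambient n) ∞
      (fun q : M × ℝ => F q.2 q.1) (univ ×ˢ Ico 0 T)) {t : ℝ} (ht : t ∈ Ico 0 T) :
    ContMDiff (𝓡 n) 𝓘(ℝ, Ambient n) ∞ (F t) := by
  rw [← contMDiffOn_univ]
  exact hF.comp (contMDiffOn_id.prodMk contMDiffOn_const) fun q _ => ⟨mem_univ _, ht⟩

variable [IsManifold (𝓡 n) ∞ M]

theorem contDiffOn_chart {F : ℝ → M → Ambient n}
    (hF : ContMDiffOn ((𝓡 n).prod 𝓘(ℝ, ℝ)) 𝓘(ℝ, Ambient n) ∞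
      (fun q : M × ℝ => F q.2 q.1) (univ ×ˢ Ico 0 T)) (p : M) :
    ContDiffOn ℝ ∞ (fun q : E × ℝ => F q.2 ((extChartAt (𝓡 n) p).symm q.1))
      ((extChartAt (𝓡 n) p).target ×ˢ Ico 0 T) := by
  rw [← contMDiffOn_iff_contDiffOn, modelWithCornersSelf_prod, ← chartedSpaceSelf_prod]
  refine hF.comp (ContMDiffOn.prodMk ?_ contMDiffOn_snd) fun q hq => ⟨mem_univ _, hq.2⟩
  exact (contMDiffOn_extChartAt_symm p).comp contMDiffOn_fst fun q hq => hq.1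

theorem chart_bijective (p : M) {y : E} (hy : y ∈ (extChartAt (𝓡 n) p).target) :
    MDifferentiableAt 𝓘(ℝ, E) (𝓡 n) (extChartAt (𝓡 n) p).symm y ∧ ∃ J : E ≃L[ℝ] E,
      mfderiv 𝓘(ℝ, E) (𝓡 n) (extChartAt (𝓡 n) p).symm y = J.toContinuousLinearMap := by
  have : IsManifold (𝓡 n) 1 M := .of_le (one_le_two.trans two_le_infty)
  refine ⟨((contMDiffOn_extChartAt_symm (n := ∞) p).contMDiffAt
    ((isOpen_extChartAt_target p).mem_nhds hy)).mdifferentiableAt (by simp), ?_⟩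
  obtain ⟨J, hJ⟩ := isInvertible_mfderivWithin_extChartAt_symm (I := 𝓡 n) (x := p) hy
  rw [ModelWithCorners.range_eq_univ, mfderivWithin_univ] at hJ
  exact ⟨J, hJ.symm⟩

/-- A flow in a chart is a local flow, with derivatives related by an isomorphism. -/
theorem IsFlow.local (hflow : IsFlow Φ T X ν) (p : M) :
    IsLocalFlow Φ T (extChartAt (𝓡 n) p).target
      (fun q => X q.2 ((extChartAt (𝓡 n) p).symm q.1))
      (fun q => ν q.2 ((extChartAt (𝓡 n) p).symm q.1)) ∧
    ∀ y ∈ (extChartAt (𝓡 n) p).target, ∃ J : E ≃L[ℝ] E, ∀ t ∈ Ico 0 T,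
      spaceDeriv (fun q => X q.2 ((extChartAt (𝓡 n) p).symm q.1)) t y =
        (tangentMap (X t) ((extChartAt (𝓡 n) p).symm y)).comp J.toContinuousLinearMap ∧
      spaceDeriv (fun q => ν q.2 ((extChartAt (𝓡 n) p).symm q.1)) t y =
        (tangentMap (ν t) ((extChartAt (𝓡 n) p).symm y)).comp J.toContinuousLinearMap ∧
      localCurvature (fun q => X q.2 ((extChartAt (𝓡 n) p).symm q.1))
        (fun q => ν q.2 ((extChartAt (𝓡 n) p).symm q.1)) t y =
        meanCurvature (X t) (ν t) ((extChartAt (𝓡 n) p).symm y) := by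
  have key : ∀ y ∈ (extChartAt (𝓡 n) p).target, ∃ J : E ≃L[ℝ] E, ∀ t ∈ Ico 0 T,
      spaceDeriv (fun q => X q.2 ((extChartAt (𝓡 n) p).symm q.1)) t y =
        (tangentMap (X t) ((extChartAt (𝓡 n) p).symm y)).comp J.toContinuousLinearMap ∧
      spaceDeriv (fun q => ν q.2 ((extChartAt (𝓡 n) p).symm q.1)) t y =
        (tangentMap (ν t) ((extChartAt (𝓡 n) p).symm y)).comp J.toContinuousLinearMap ∧
      localCurvature (fun q => X q.2 ((extChartAt (𝓡 n) p).symm q.1))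
        (fun q => ν q.2 ((extChartAt (𝓡 n) p).symm q.1)) t y =
        meanCurvature (X t) (ν t) ((extChartAt (𝓡 n) p).symm y) := by
    intro y hy
    -- The `mfderiv` at a point refers to the preferred chart there, not to the chart at p; J
    -- compares the two. It does not depend on t, so a fixed coordinate direction is a fixed tangent
    -- vector throughout the flow.
    obtain ⟨hθ, J, hJ⟩ := chart_bijective p hy
    have hd : ∀ {F : M → Ambient n}, ContMDiff (𝓡 n) 𝓘(ℝ, Ambient n) ∞ F →
        fderiv ℝ (fun z => F ((extChartAt (𝓡 n) p).symm z)) y =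
        (tangentMap F ((extChartAt (𝓡 n) p).symm y)).comp J.toContinuousLinearMap := by
      intro F hF
      rw [← mfderiv_eq_fderiv, ← hJ]
      exact mfderiv_comp y (hF.mdifferentiableAt (by simp)) hθ
    refine ⟨J, fun t ht => ?_⟩
    have h1 := hd (contMDiff_slice hflow.smooth ht)
    have h2 := hd (contMDiff_slice hflow.smooth_normal ht)
    refine ⟨h1, h2, ?_⟩
    rw [localCurvature, spaceDeriv, spaceDeriv, h1, h2, trace_gram_comp _ _ _ J.injective]
    rfl
  refine ⟨⟨isOpen_extChartAt_target p, contDiffOn_chart hflow.smooth p,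
    contDiffOn_chart hflow.smooth_normal p, ?_, fun t ht y _ => hflow.norm_normal t ht _, ?_, ?_⟩,
    key⟩
  · intro t ht y hy
    obtain ⟨J, hJ⟩ := key y hy
    rw [(hJ t ht).1]
    exact (hflow.immersion t ht _).comp J.injective
  · intro t ht y hy v
    obtain ⟨J, hJ⟩ := key y hy
    rw [(hJ t ht).1]
    rw [ContinuousLinearMap.comp_apply, apply_eq_sum_single, inner_sum]
    refine Finset.sum_eq_zero fun i _ => ?_
    rw [inner_smul_right]
    exact mul_eq_zero_of_right _ (hflow.inner_normal t ht _ i)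
  · intro t ht y hy
    obtain ⟨J, hJ⟩ := key y hy
    rw [(hJ t ht).2.2]
    exact hflow.evolution t ht ((extChartAt (𝓡 n) p).symm y)

end Chart

/-! ### Geometry of a graph over the tangent plane -/

section Graph

variable {n : ℕ} {Φ : ℝ → ℝ} {T t₁ : ℝ} {U : Set (EuclideanSpace ℝ (Fin n))}
  {Y N : EuclideanSpace ℝ (Fin n) × ℝ → Ambient n}

/-- A diagonalizing basis of the Hessian. -/
theorem exists_hessian_basis {u : EuclideanSpace ℝ (Fin n) → ℝ} (hu : ContDiff ℝ ∞ u) :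
    ∃ (b : OrthonormalBasis (Fin n) ℝ (EuclideanSpace ℝ (Fin n))) (l : Fin n → ℝ),
      ∀ i j, dir (b i) (dir (b j) u) 0 = if i = j then l i else 0 := by
  let b₀ := EuclideanSpace.basisFun (Fin n) ℝ
  let S : EuclideanSpace ℝ (Fin n) →ₗ[ℝ] EuclideanSpace ℝ (Fin n) :=
    { toFun := fun v => ∑ i, dir v (dir (b₀ i) u) 0 • b₀ i
      map_add' := fun v w => by simp only [dir_add_left, add_smul, Finset.sum_add_distrib]
      map_smul' := fun c v => by
        simp only [dir_smul_left, smul_assoc, Finset.smul_sum, RingHom.id_apply] }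
  have hS : ∀ v w, inner ℝ (S v) w = dir v (dir w u) 0 := by
    intro v w
    rw [dir_comm hu, dir_eq_sum b₀ w]
    simp only [S, LinearMap.coe_mk, AddHom.coe_mk, sum_inner, inner_smul_left, conj_trivial,
      smul_eq_mul]
    exact Finset.sum_congr rfl fun i _ => by rw [dir_comm hu v, mul_comm]
  have hsymm : S.IsSymmetric := fun v w => by
    rw [hS, real_inner_comm, hS, dir_comm hu]
  refine ⟨hsymm.eigenvectorBasis (by simp), hsymm.eigenvalues (by simp), fun i j => ?_⟩
  rw [← hS, hsymm.apply_eigenvectorBasis, inner_smul_left, OrthonormalBasis.inner_eq_ite]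
  simp

/-- A flow which at the time `t₁` is the graph of `-u` over its tangent plane. -/
structure IsGraphAt (t₁ : ℝ) (U : Set (EuclideanSpace ℝ (Fin n)))
    (Y N : EuclideanSpace ℝ (Fin n) × ℝ → Ambient n) (x₀ : Ambient n)
    (L : EuclideanSpace ℝ (Fin n) →ₗᵢ[ℝ] Ambient n) (u : EuclideanSpace ℝ (Fin n) → ℝ) : Prop where
  zero_mem : (0 : EuclideanSpace ℝ (Fin n)) ∈ U
  smooth : ContDiff ℝ ∞ u
  eq : ∀ y ∈ U, Y (y, t₁) = x₀ + L y - u y • N (0, t₁)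
  inner_eq : ∀ v, inner ℝ (L v) (N (0, t₁)) = 0
  exists_eq : ∀ a, inner ℝ a (N (0, t₁)) = 0 → ∃ v, L v = a

variable {x₀ : Ambient n} {L : EuclideanSpace ℝ (Fin n) →ₗᵢ[ℝ] Ambient n}
  {u : EuclideanSpace ℝ (Fin n) → ℝ}

namespace IsGraphAt

theorem contDiff_graph (hg : IsGraphAt t₁ U Y N x₀ L u) :
    ContDiff ℝ ∞ fun y => x₀ + L y - u y • N (0, t₁) :=
  (contDiff_const.add L.contDiff).sub (hg.smooth.smul contDiff_const)

theorem dir_graph (hg : IsGraphAt t₁ U Y N x₀ L u) (v : EuclideanSpace ℝ (Fin n)) :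
    dir v (fun y => x₀ + L y - u y • N (0, t₁)) = fun y => L v - dir v u y • N (0, t₁) := by
  funext y
  have h1 : HasFDerivAt (fun y => x₀ + L y - u y • N (0, t₁))
      (L.toContinuousLinearMap - (fderiv ℝ u y).smulRight (N (0, t₁))) y :=
    (L.toContinuousLinearMap.hasFDerivAt.const_add x₀).sub
      ((diffAt hg.smooth y).hasFDerivAt.smul_const _)
  rw [dir, h1.fderiv]
  rfl

theorem dir_dir_graph (hg : IsGraphAt t₁ U Y N x₀ L u) (v w : EuclideanSpace ℝ (Fin n))
    (y : EuclideanSpace ℝ (Fin n)) :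
    dir v (dir w fun y => x₀ + L y - u y • N (0, t₁)) y = -(dir v (dir w u) y • N (0, t₁)) := by
  rw [hg.dir_graph]
  have h1 : HasFDerivAt (fun y => L w - dir w u y • N (0, t₁))
      (0 - (fderiv ℝ (dir w u) y).smulRight (N (0, t₁))) y :=
    (hasFDerivAt_const _ _).sub
      ((diffAt (contDiff_dir hg.smooth w) y).hasFDerivAt.smul_const _)
  rw [dir, h1.fderiv]
  simp [dir]

theorem eventuallyEq (hg : IsGraphAt t₁ U Y N x₀ L u) (hf : IsLocalFlow Φ T U Y N)
    {y : EuclideanSpace ℝ (Fin n)} (hy : y ∈ U) :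
    (fun y => x₀ + L y - u y • N (0, t₁)) =ᶠ[𝓝 y] fun z => Y (z, t₁) := by
  filter_upwards [hf.isOpen.mem_nhds hy] with z hz using (hg.eq z hz).symm

theorem spaceDeriv_eq (hg : IsGraphAt t₁ U Y N x₀ L u) (hf : IsLocalFlow Φ T U Y N)
    {y : EuclideanSpace ℝ (Fin n)} (hy : y ∈ U) (v : EuclideanSpace ℝ (Fin n)) :
    spaceDeriv Y t₁ y v = L v - dir v u y • N (0, t₁) :=
  ((dir_congr (hg.eventuallyEq hf hy) v).self_of_nhds.symm.trans (congrFun (hg.dir_graph v) y))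

theorem inner_normal_self (ht₁ : t₁ ∈ Ico 0 T)
    (hg : IsGraphAt t₁ U Y N x₀ L u) (hf : IsLocalFlow Φ T U Y N) :
    inner ℝ (N (0, t₁)) (N (0, t₁)) = (1 : ℝ) := by
  rw [real_inner_self_eq_norm_sq, hf.norm_normal t₁ ht₁ 0 hg.zero_mem, one_pow]

theorem metric_eq (ht₁ : t₁ ∈ Ico 0 T)
    (hg : IsGraphAt t₁ U Y N x₀ L u) (hf : IsLocalFlow Φ T U Y N)
    {y : EuclideanSpace ℝ (Fin n)} (hy : y ∈ U) (v w : EuclideanSpace ℝ (Fin n)) :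
    inner ℝ (spaceDeriv Y t₁ y v) (spaceDeriv Y t₁ y w) =
      (inner ℝ v w + dir v u y * dir w u y : ℝ) := by
  rw [hg.spaceDeriv_eq hf hy, hg.spaceDeriv_eq hf hy]
  simp only [inner_sub_left, inner_sub_right, inner_smul_left, inner_smul_right, hg.inner_eq,
    real_inner_comm (L w) (N (0, t₁)), hg.inner_normal_self ht₁ hf, LinearIsometry.inner_map_map]
  simp
  ring

theorem dir_zero (ht₁ : t₁ ∈ Ico 0 T)
    (hg : IsGraphAt t₁ U Y N x₀ L u) (hf : IsLocalFlow Φ T U Y N)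
    (v : EuclideanSpace ℝ (Fin n)) : dir v u 0 = 0 := by
  have h := hf.inner_normal t₁ ht₁ 0 hg.zero_mem v
  rw [hg.spaceDeriv_eq hf hg.zero_mem, inner_sub_right, inner_smul_right,
    hg.inner_normal_self ht₁ hf, real_inner_comm, hg.inner_eq] at h
  linarith

/-- Write N(y) = L v + m N(0). Orthogonality to the graph gives v = m ∇u, unit length gives m²(1 +
|∇u|²) = 1, and `hpos` selects the positive root. -/
theorem inner_normal_eq (ht₁ : t₁ ∈ Ico 0 T)
    (hg : IsGraphAt t₁ U Y N x₀ L u) (hf : IsLocalFlow Φ T U Y N)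
    (b : OrthonormalBasis (Fin n) ℝ (EuclideanSpace ℝ (Fin n)))
    {y : EuclideanSpace ℝ (Fin n)} (hy : y ∈ U)
    (hpos : (0 : ℝ) < inner ℝ (N (y, t₁)) (N (0, t₁))) :
    inner ℝ (N (y, t₁)) (N (0, t₁)) = slope b u y := by
  set m : ℝ := inner ℝ (N (y, t₁)) (N (0, t₁)) with hm
  have h00 := hg.inner_normal_self ht₁ hf
  obtain ⟨v, hv⟩ := hg.exists_eq (N (y, t₁) - m • N (0, t₁)) (by
    rw [inner_sub_left, inner_smul_left, h00]; simp [hm])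
  have hN : N (y, t₁) = L v + m • N (0, t₁) := by rw [hv]; abel
  have hvw : ∀ w, inner ℝ (b w) v = m * dir (b w) u y := by
    intro w
    have h := hf.inner_normal t₁ ht₁ y hy (b w)
    rw [hg.spaceDeriv_eq hf hy, hN] at h
    simp only [inner_add_left, inner_sub_right, inner_smul_left, inner_smul_right, hg.inner_eq,
      h00, LinearIsometry.inner_map_map, real_inner_comm (L (b w)) (N (0, t₁)), conj_trivial] at h
    rw [real_inner_comm]
    linarith
  have hsq : m ^ 2 * (1 + gradSq b u y) = 1 := by
    have h1 : inner ℝ (N (y, t₁)) (N (y, t₁)) = (1 : ℝ) := by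
      rw [real_inner_self_eq_norm_sq, hf.norm_normal t₁ ht₁ y hy, one_pow]
    have h2 : inner ℝ v v = m ^ 2 * gradSq b u y := by
      rw [← b.sum_inner_mul_inner, gradSq, Finset.mul_sum]
      refine Finset.sum_congr rfl fun i _ => ?_
      rw [real_inner_comm (b i) v, hvw]
      ring
    rw [hN] at h1
    simp only [inner_add_left, inner_add_right, inner_smul_left, inner_smul_right, hg.inner_eq,
      h00, LinearIsometry.inner_map_map, real_inner_comm (L v) (N (0, t₁)), conj_trivial, h2] at h1
    linarith
  have hq : 0 ≤ gradSq b u y := Finset.sum_nonneg fun i _ => mul_self_nonneg _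
  have h3 : 1 + gradSq b u y = (m ^ 2)⁻¹ := by
    field_simp
    linarith
  rw [slope, h3, ← Real.rpow_natCast, ← Real.rpow_neg hpos.le, ← Real.rpow_mul hpos.le]
  norm_num

theorem secondForm_eq (ht₁ : t₁ ∈ Ico 0 T)
    (hg : IsGraphAt t₁ U Y N x₀ L u) (hf : IsLocalFlow Φ T U Y N)
    (b : OrthonormalBasis (Fin n) ℝ (EuclideanSpace ℝ (Fin n)))
    {y : EuclideanSpace ℝ (Fin n)} (hy : y ∈ U)
    (hpos : (0 : ℝ) < inner ℝ (N (y, t₁)) (N (0, t₁))) (v w : EuclideanSpace ℝ (Fin n)) :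
    inner ℝ (spaceDeriv N t₁ y v) (spaceDeriv Y t₁ y w) = slope b u y * dir v (dir w u) y := by
  rw [hf.secondForm_eq_neg ht₁ hy hg.contDiff_graph (hg.eventuallyEq hf hy), hg.dir_dir_graph,
    inner_neg_right, inner_smul_right, hg.inner_normal_eq ht₁ hf b hy hpos]
  ring

/-- In the basis b the metric is 1 + p pᵀ with p = ∇u, whose inverse is 1 - slope² p pᵀ, and the
second form is slope times the Hessian of u. -/
theorem localCurvature_eq (ht₁ : t₁ ∈ Ico 0 T)
    (hg : IsGraphAt t₁ U Y N x₀ L u) (hf : IsLocalFlow Φ T U Y N)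
    (b : OrthonormalBasis (Fin n) ℝ (EuclideanSpace ℝ (Fin n)))
    {y : EuclideanSpace ℝ (Fin n)} (hy : y ∈ U)
    (hpos : (0 : ℝ) < inner ℝ (N (y, t₁)) (N (0, t₁))) :
    localCurvature Y N t₁ y = graphCurvature b u y := by
  let O := (EuclideanSpace.basisFun (Fin n) ℝ).equiv b (Equiv.refl _)
  have hO : ∀ i, O (EuclideanSpace.single i 1) = b i := fun i => by
    have := (EuclideanSpace.basisFun (Fin n) ℝ).equiv_apply_basis b (Equiv.refl _) i
    simpa using this
  rw [localCurvature, ← trace_gram_comp _ _ O.toContinuousLinearEquiv.toContinuousLinearMap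
    O.injective]
  have hs : slope b u y * slope b u y * (1 + gradSq b u y) = 1 := by
    have hq : 0 < 1 + gradSq b u y :=
      add_pos_of_pos_of_nonneg one_pos (Finset.sum_nonneg fun i _ => mul_self_nonneg _)
    rw [slope, ← Real.rpow_add hq]
    norm_num
    rw [Real.rpow_neg_one, inv_mul_cancel₀ hq.ne']
  set p : Fin n → ℝ := fun i => dir (b i) u y with hp
  have h1 : gram ((spaceDeriv Y t₁ y).comp O.toContinuousLinearEquiv.toContinuousLinearMap)
      ((spaceDeriv Y t₁ y).comp O.toContinuousLinearEquiv.toContinuousLinearMap) =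
      1 + Matrix.vecMulVec p p := by
    ext i j
    simp only [gram, Matrix.of_apply, ContinuousLinearMap.comp_apply]
    erw [hO i, hO j]
    rw [hg.metric_eq ht₁ hf hy, b.inner_eq_ite]
    simp [Matrix.one_apply, Matrix.vecMulVec_apply, hp]
  have h2 : gram ((spaceDeriv N t₁ y).comp O.toContinuousLinearEquiv.toContinuousLinearMap)
      ((spaceDeriv Y t₁ y).comp O.toContinuousLinearEquiv.toContinuousLinearMap) =
      slope b u y • Matrix.of fun i j => dir (b i) (dir (b j) u) y := by
    ext i j
    simp only [gram, Matrix.of_apply, ContinuousLinearMap.comp_apply]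
    erw [hO i, hO j]
    rw [hg.secondForm_eq ht₁ hf b hy hpos]
    rfl
  have hpp : p ⬝ᵥ p = gradSq b u y := rfl
  have h3 : (1 + Matrix.vecMulVec p p)⁻¹ =
      1 - (slope b u y * slope b u y) • Matrix.vecMulVec p p := by
    refine Matrix.inv_eq_right_inv ?_
    have h4 : Matrix.vecMulVec p p * Matrix.vecMulVec p p = gradSq b u y • Matrix.vecMulVec p p := by
      rw [Matrix.vecMulVec_mul_vecMulVec, hpp]
      ext i j
      simp [Matrix.vecMulVec_apply]
      ring
    have h5 : (1 + Matrix.vecMulVec p p) *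
        (1 - (slope b u y * slope b u y) • Matrix.vecMulVec p p) =
        1 + (1 - slope b u y * slope b u y * (1 + gradSq b u y)) • Matrix.vecMulVec p p := by
      rw [add_mul, mul_sub, mul_sub, mul_one, one_mul, mul_one, Matrix.mul_smul, h4]
      module
    rw [h5, hs, sub_self, zero_smul, add_zero]
  rw [h1, h2, h3, graphCurvature, Matrix.mul_smul, Matrix.trace_smul, sub_mul, one_mul,
    Matrix.trace_sub, smul_eq_mul, Matrix.smul_mul, Matrix.trace_smul, smul_eq_mul]
  congr 2
  congr 1
  simp only [Matrix.trace, Matrix.diag_apply, Matrix.mul_apply, Matrix.vecMulVec_apply,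
    Matrix.of_apply, hp]
  refine Finset.sum_congr rfl fun i _ => Finset.sum_congr rfl fun j _ => ?_
  rw [dir_comm hg.smooth (b j) (b i)]
  ring

end IsGraphAt

end Graph

theorem dir_prod_left {V W : Type*} [NormedAddCommGroup V] [NormedSpace ℝ V]
    [NormedAddCommGroup W] [NormedSpace ℝ W] {G : V × ℝ → W} {y : V} {t : ℝ}
    (hG : DifferentiableAt ℝ G (y, t)) (v : V) :
    dir (v, 0) G (y, t) = dir v (fun z => G (z, t)) y := by
  have h := HasFDerivAt.comp (g := G) (f := fun z => (z, t)) y hG.hasFDerivAt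
    (hasFDerivAt_prodMk_left y t)
  have h' : HasFDerivAt (fun z => G (z, t))
    ((fderiv ℝ G (y, t)).comp (ContinuousLinearMap.inl ℝ V ℝ)) y := h
  rw [dir, dir, h'.fderiv]
  rfl

theorem hasDerivAt_prod_right {V W : Type*} [NormedAddCommGroup V] [NormedSpace ℝ V]
    [NormedAddCommGroup W] [NormedSpace ℝ W] {G : V × ℝ → W} {y : V} {t : ℝ}
    (hG : DifferentiableAt ℝ G (y, t)) :
    HasDerivAt (fun s => G (y, s)) (dir ((0 : V), (1 : ℝ)) G (y, t)) t :=
  hG.hasFDerivAt.comp_hasDerivAt t ((hasDerivAt_const t y).prodMk (hasDerivAt_id t))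

theorem hasDerivAt_nonpos_of_left {m : ℝ → ℝ} {c t : ℝ} (hm : HasDerivAt m c t) (h0 : m t = 0)
    (h : ∀ᶠ s in 𝓝[<] t, 0 ≤ m s) : c ≤ 0 := by
  have h1 := (hasDerivWithinAt_iff_tendsto_slope' (by simp)).1 (hm.hasDerivWithinAt (s := Iio t))
  refine le_of_tendsto h1 ?_
  filter_upwards [h, self_mem_nhdsWithin] with s hs hst
  rw [_root_.slope_def_field, h0, sub_zero]
  exact div_nonpos_of_nonneg_of_nonpos hs (sub_nonpos.2 (le_of_lt hst))

/-- The second derivative of `Φ(H)` is nonnegative where `H H'' ≥ 2 (H')²`. -/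
theorem HasTwoDeriv.comp_speed {Φ : ℝ → ℝ} (hΦ : ContDiffOn ℝ ∞ Φ (Ioi 0))
    (hΦ' : ∀ x ∈ Ioi (0 : ℝ), 0 < deriv Φ x)
    (hΦ'' : ∀ x ∈ Ioi (0 : ℝ), -2 * deriv Φ x / x ≤ deriv (deriv Φ) x)
    {f : ℝ → ℝ} {H₀ H₁ H₂ : ℝ} (hf : HasTwoDeriv f H₀ H₁ H₂) (h0 : 0 < H₀)
    (h2 : 2 * H₁ ^ 2 ≤ H₂ * H₀) :
    ∃ b c, HasTwoDeriv (fun s => Φ (f s)) (Φ H₀) b c ∧ 0 ≤ c := by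
  have hd : ∀ᶠ x in 𝓝 H₀, HasDerivAt Φ (deriv Φ x) x := by
    filter_upwards [isOpen_Ioi.mem_nhds h0] with x hx
    exact ((hΦ.contDiffAt (isOpen_Ioi.mem_nhds hx)).differentiableAt (by simp)).hasDerivAt
  have hdd : HasDerivAt (deriv Φ) (deriv (deriv Φ) H₀) H₀ := by
    have h1 := hΦ.deriv_of_isOpen (m := 1) isOpen_Ioi (by norm_num; exact two_le_infty)
    exact ((h1.contDiffAt (isOpen_Ioi.mem_nhds h0)).differentiableAt (by simp)).hasDerivAt
  -- The second derivative is Φ'' H₁² + Φ' H₂; the lower bounds -2Φ'/H₀ for Φ'' and 2H₁²/H₀ for H₂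
  -- cancel exactly.
  refine ⟨_, _, HasTwoDeriv.comp hd hdd hf, ?_⟩
  have h3 := mul_le_mul_of_nonneg_right (hΦ'' H₀ h0) (sq_nonneg H₁)
  have h4 : deriv Φ H₀ * (2 * H₁ ^ 2 / H₀) ≤ deriv Φ H₀ * H₂ :=
    mul_le_mul_of_nonneg_left ((div_le_iff₀ h0).2 h2) (hΦ' H₀ h0).le
  have h5 : -2 * deriv Φ H₀ / H₀ * H₁ ^ 2 = -(deriv Φ H₀ * (2 * H₁ ^ 2 / H₀)) := by ring
  linarith

/-! ### The touching point in graph coordinates -/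

section Touching

variable {n : ℕ} {Φ : ℝ → ℝ} {T t₁ : ℝ} {U : Set (EuclideanSpace ℝ (Fin n))}
  {Y N : EuclideanSpace ℝ (Fin n) × ℝ → Ambient n}
  {x₀ : Ambient n} {L : EuclideanSpace ℝ (Fin n) →ₗᵢ[ℝ] Ambient n}
  {u : EuclideanSpace ℝ (Fin n) → ℝ}

/-- At a minimum of the curvature, the mean curvature of a graph satisfies the differential
inequality of `graphCurvature_inequality`. -/
theorem IsGraphAt.curvature_inequality (hg : IsGraphAt t₁ U Y N x₀ L u)
    (hf : IsLocalFlow Φ T U Y N) (ht₁ : t₁ ∈ Ico 0 T) {lam : ℝ} (hlam : 0 < lam)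
    (hmin : ∀ y ∈ U, ∀ v, lam * inner ℝ (spaceDeriv Y t₁ y v) (spaceDeriv Y t₁ y v) ≤
      inner ℝ (spaceDeriv N t₁ y v) (spaceDeriv Y t₁ y v))
    {e : EuclideanSpace ℝ (Fin n)} (he1 : ‖e‖ = 1)
    (he : ∀ w, inner ℝ (spaceDeriv N t₁ 0 w) (spaceDeriv Y t₁ 0 e) =
      lam * inner ℝ (spaceDeriv Y t₁ 0 w) (spaceDeriv Y t₁ 0 e)) :
    dir e (dir e u) 0 = lam ∧
    ∃ H₁ H₂, HasTwoDeriv (fun s => localCurvature Y N t₁ (s • e)) (localCurvature Y N t₁ 0) H₁ H₂ ∧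
      lam ≤ localCurvature Y N t₁ 0 ∧ 2 * H₁ ^ 2 ≤ H₂ * localCurvature Y N t₁ 0 := by
  obtain ⟨b, l, hl⟩ := exists_hessian_basis hg.smooth
  have h0U := hg.zero_mem
  have hNc : ContinuousAt (fun y => N (y, t₁)) 0 :=
    ((contDiffOn_slice hf.smooth_normal ht₁).contDiffAt (hf.isOpen.mem_nhds h0U)).continuousAt
  have hpos : ∀ᶠ y in 𝓝 0, (0 : ℝ) < inner ℝ (N (y, t₁)) (N (0, t₁)) :=
    (hNc.inner (𝕜 := ℝ) continuousAt_const).eventually_const_lt (by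
      exact one_pos.trans_eq (hg.inner_normal_self ht₁ hf).symm)
  have hd0 := fun v => hg.dir_zero ht₁ hf v
  have hs0 : slope b u 0 = 1 := by simp [slope, gradSq, hd0]
  have hw : ∀ w, dir w (dir e u) 0 = lam * inner ℝ w e := by
    intro w
    have h1 := he w
    rw [hg.secondForm_eq ht₁ hf b h0U hpos.self_of_nhds, hg.metric_eq ht₁ hf h0U, hs0, hd0,
      hd0] at h1
    linarith
  have hmin' : ∀ᶠ y in 𝓝 (0 : EuclideanSpace ℝ (Fin n)), ∀ v,
      lam * (inner ℝ v v + dir v u y * dir v u y) ≤ slope b u y * dir v (dir v u) y := by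
    filter_upwards [hf.isOpen.mem_nhds h0U, hpos] with y hy hp v
    rw [← hg.metric_eq ht₁ hf hy, ← hg.secondForm_eq ht₁ hf b hy hp]
    exact hmin y hy v
  have hle : ∀ i, l i * inner ℝ (b i) e = lam * inner ℝ (b i) e := by
    intro i
    rw [← hw, dir_comm hg.smooth, dir_eq_sum b e]
    simp [hl, mul_comm]
  have hline : Tendsto (fun s : ℝ => s • e) (𝓝 0) (𝓝 0) := by
    have : Continuous fun s : ℝ => s • e := by fun_prop
    simpa using this.tendsto 0
  obtain ⟨H₀, H₁, H₂, hH, h1, h2⟩ :=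
    graphCurvature_inequality hg.smooth (fun i => hd0 _) hl hlam hmin' he1 hle
  have hH' : HasTwoDeriv (fun s => localCurvature Y N t₁ (s • e)) H₀ H₁ H₂ := by
    refine hH.congr ?_
    filter_upwards [hline.eventually hpos, hline.eventually (hf.isOpen.mem_nhds h0U)] with s hp hs
    exact (hg.localCurvature_eq ht₁ hf b hs hp).symm
  have hval : localCurvature Y N t₁ 0 = H₀ := by simpa using hH'.1
  refine ⟨?_, H₁, H₂, hval ▸ hH', hval ▸ h1, hval ▸ h2⟩
  rw [hw, real_inner_self_eq_norm_sq, he1]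
  ring

/-- The maximum principle at a touching point, in graph coordinates. -/
theorem IsGraphAt.touching (hΦ : ContDiffOn ℝ ∞ Φ (Ioi 0))
    (hΦ' : ∀ x ∈ Ioi (0 : ℝ), 0 < deriv Φ x)
    (hΦ'' : ∀ x ∈ Ioi (0 : ℝ), -2 * deriv Φ x / x ≤ deriv (deriv Φ) x)
    (hg : IsGraphAt t₁ U Y N x₀ L u)
    (hf : IsLocalFlow Φ T U Y N) (ht₁ : t₁ ∈ Ioo 0 T) {φ : ℝ → ℝ} {d : ℝ} (hlam : 0 < φ t₁)
    (hφ : HasDerivAt φ d t₁)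
    (hmin : ∀ y ∈ U, ∀ v, φ t₁ * inner ℝ (spaceDeriv Y t₁ y v) (spaceDeriv Y t₁ y v) ≤
      inner ℝ (spaceDeriv N t₁ y v) (spaceDeriv Y t₁ y v))
    {e : EuclideanSpace ℝ (Fin n)} (he1 : ‖e‖ = 1)
    (hee : inner ℝ (spaceDeriv N t₁ 0 e) (spaceDeriv Y t₁ 0 e) =
      φ t₁ * inner ℝ (spaceDeriv Y t₁ 0 e) (spaceDeriv Y t₁ 0 e))
    (hpast : ∀ᶠ t in 𝓝[<] t₁, φ t * inner ℝ (spaceDeriv Y t 0 e) (spaceDeriv Y t 0 e) ≤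
      inner ℝ (spaceDeriv N t 0 e) (spaceDeriv Y t 0 e)) :
    φ t₁ ≤ localCurvature Y N t₁ 0 ∧ Φ (localCurvature Y N t₁ 0) * φ t₁ ^ 2 ≤ d := by
  have ht₁' : t₁ ∈ Ico 0 T := ⟨ht₁.1.le, ht₁.2⟩
  have h0U := hg.zero_mem
  have heig := eigenvector_of_min (hf.symm ht₁' h0U) (hmin 0 h0U) hee
  obtain ⟨hu2, H₁, H₂, hH, hlamH, hineq⟩ :=
    hg.curvature_inequality hf ht₁' hlam hmin he1 heig
  set H₀ := localCurvature Y N t₁ 0 with hH₀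
  refine ⟨hlamH, ?_⟩
  obtain ⟨β, γ, hΦH, hγ⟩ := hH.comp_speed hΦ hΦ' hΦ'' (hlam.trans_le hlamH) hineq
  -- As t₁ is an interior time, Y and N are smooth in a full space-time neighbourhood of q and have
  -- smooth global representatives F and G.
  set Ω : Set (EuclideanSpace ℝ (Fin n) × ℝ) := U ×ˢ Ioo 0 T with hΩdef
  have hΩ : IsOpen Ω := hf.isOpen.prod isOpen_Ioo
  have hΩsub : Ω ⊆ U ×ˢ Ico 0 T := prod_mono_right Ioo_subset_Ico_self
  set q : EuclideanSpace ℝ (Fin n) × ℝ := (0, t₁) with hq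
  have hqΩ : q ∈ Ω := ⟨h0U, ht₁⟩
  obtain ⟨F, hFs, hFe⟩ := exists_contDiff_eventuallyEq hΩ (hf.smooth.mono hΩsub) hqΩ
  obtain ⟨G, hGs, hGe⟩ := exists_contDiff_eventuallyEq hΩ (hf.smooth_normal.mono hΩsub) hqΩ
  set τ : EuclideanSpace ℝ (Fin n) × ℝ := (0, 1) with hτ
  set ε : EuclideanSpace ℝ (Fin n) × ℝ := (e, 0) with hε
  have hslice : ∀ {W : Type} [NormedAddCommGroup W] [NormedSpace ℝ W]
      {K K' : EuclideanSpace ℝ (Fin n) × ℝ → W}, ContDiff ℝ ∞ K' → K' =ᶠ[𝓝 q] K →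
      ∀ᶠ x in 𝓝 q, ∀ v, dir (v, 0) K' x = dir v (fun z => K (z, x.2)) x.1 := by
    intro W _ _ K K' hK' hK
    filter_upwards [hK.eventually_nhds] with x hx v
    rw [dir_prod_left (diffAt hK' x) v]
    have hc : Tendsto (fun z => (z, x.2)) (𝓝 x.1) (𝓝 x) :=
      (Continuous.prodMk continuous_id continuous_const).tendsto x.1
    exact (dir_congr (hc.eventually (p := fun w => K' w = K w) hx) v).self_of_nhds
  have hFsp : ∀ᶠ x in 𝓝 q, ∀ v, dir (v, 0) F x = spaceDeriv Y x.2 x.1 v := hslice hFs hFe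
  have hGsp : ∀ᶠ x in 𝓝 q, ∀ v, dir (v, 0) G x = spaceDeriv N x.2 x.1 v := hslice hGs hGe
  -- A smooth stand-in for the speed, equal to Φ(H) near q, so that joint smoothness of H need not
  -- be established.
  set Ψ : EuclideanSpace ℝ (Fin n) × ℝ → ℝ := fun x => -inner ℝ (dir τ F x) (G x) with hΨ
  have hΨs : ContDiff ℝ ∞ Ψ := ((contDiff_dir hFs τ).inner ℝ hGs).neg
  have hGG : ∀ᶠ x in 𝓝 q, inner ℝ (G x) (G x) = (1 : ℝ) := by
    filter_upwards [hGe, hΩ.mem_nhds hqΩ] with x h1 h2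
    rw [h1, real_inner_self_eq_norm_sq, hf.norm_normal _ (Ioo_subset_Ico_self h2.2) _ h2.1,
      one_pow]
  have hFt : ∀ᶠ x in 𝓝 q, dir τ F x = -(Φ (localCurvature Y N x.2 x.1)) • G x := by
    filter_upwards [hFe.eventually_nhds, hGe, hΩ.mem_nhds hqΩ] with x h1 h2 h3
    have h4 := (hf.evolution x.2 (Ioo_subset_Ico_self h3.2) x.1 h3.1).hasDerivAt
      (Ico_mem_nhds h3.2.1 h3.2.2)
    have hc : Tendsto (fun s => (x.1, s)) (𝓝 x.2) (𝓝 x) :=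
      (Continuous.prodMk continuous_const continuous_id).tendsto x.2
    rw [h2]
    exact (hasDerivAt_prod_right (diffAt hFs x)).unique
      (h4.congr_of_eventuallyEq (hc.eventually (p := fun w => F w = Y w) h1))
  have hΨe : ∀ᶠ x in 𝓝 q, Ψ x = Φ (localCurvature Y N x.2 x.1) := by
    filter_upwards [hFt, hGG] with x h1 h2
    simp only [hΨ]
    rw [h1, inner_smul_left, h2]
    simp
  have hFt' : ∀ᶠ x in 𝓝 q, dir τ F x = -(Ψ x) • G x := by
    filter_upwards [hFt, hΨe] with x h1 h2
    rw [h1, h2]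
  have hGF : ∀ᶠ x in 𝓝 q, inner ℝ (G x) (dir ε F x) = 0 := by
    filter_upwards [hGe, hFsp, hΩ.mem_nhds hqΩ] with x h1 h2 h3
    rw [h1, hε, h2]
    exact hf.inner_normal _ (Ioo_subset_Ico_self h3.2) _ h3.1 _
  have hGq : G q = N (0, t₁) := hGe.self_of_nhds
  have hc0 : Tendsto (fun z : EuclideanSpace ℝ (Fin n) => (z, t₁)) (𝓝 0) (𝓝 q) :=
    (Continuous.prodMk continuous_id continuous_const).tendsto 0
  -- In graph coordinates ∂_e ∂_e F is normal, with coefficient -∂_e ∂_e u(0) = -φ(t₁).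
  have hFee : dir ε (dir ε F) q = (-φ t₁) • G q := by
    rw [hq, hε, dir_prod_left (diffAt (contDiff_dir hFs _) _)]
    have h1 : (fun z => dir (e, (0 : ℝ)) F (z, t₁)) =ᶠ[𝓝 0]
        dir e fun y => x₀ + L y - u y • N (0, t₁) := by
      filter_upwards [hc0.eventually hFsp, hf.isOpen.mem_nhds h0U] with z h1 h2
      rw [h1, hg.dir_graph]
      exact hg.spaceDeriv_eq hf h2 e
    rw [(dir_congr h1 e).self_of_nhds, hg.dir_dir_graph, hu2, ← hq, hGq, neg_smul]
  have hYe : spaceDeriv Y t₁ 0 e = L e := by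
    rw [hg.spaceDeriv_eq hf h0U, hg.dir_zero ht₁' hf, zero_smul, sub_zero]
  have hee1 : inner ℝ (spaceDeriv Y t₁ 0 e) (spaceDeriv Y t₁ 0 e) = (1 : ℝ) := by
    rw [hYe, LinearIsometry.inner_map_map, real_inner_self_eq_norm_sq, he1, one_pow]
  -- ∂_e N has no normal part because |N| = 1; the eigenvector equation determines its tangential
  -- part.
  have hNe : spaceDeriv N t₁ 0 e = φ t₁ • spaceDeriv Y t₁ 0 e := by
    have hn : inner ℝ (spaceDeriv N t₁ 0 e) (N (0, t₁)) = (0 : ℝ) := by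
      have hc : (fun x => (inner ℝ (G x) (G x) : ℝ)) =ᶠ[𝓝 q] fun _ => 1 := hGG
      have h1 := (dir_congr hc ε).self_of_nhds
      rw [dir_inner (diffAt hGs q) (diffAt hGs q), dir_const, real_inner_comm,
        hGsp.self_of_nhds, hGq] at h1
      rw [real_inner_comm]
      linarith
    obtain ⟨w, hw⟩ := hg.exists_eq (spaceDeriv N t₁ 0 e - φ t₁ • spaceDeriv Y t₁ 0 e) (by
      rw [inner_sub_left, inner_smul_left, hn, hYe, hg.inner_eq]; simp)
    have hw' : L w = spaceDeriv Y t₁ 0 w := by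
      rw [hg.spaceDeriv_eq hf h0U, hg.dir_zero ht₁' hf, zero_smul, sub_zero]
    have h2 : inner ℝ (L w) (L w) = (0 : ℝ) := by
      nth_rewrite 1 [hw]
      rw [hw', inner_sub_left, inner_smul_left, hf.symm ht₁' h0U, heig,
        real_inner_comm (spaceDeriv Y t₁ 0 w)]
      simp
    rw [inner_self_eq_zero.1 h2] at hw
    exact (sub_eq_zero.1 hw.symm)
  have hFq : dir ε F q = spaceDeriv Y t₁ 0 e := hFsp.self_of_nhds e
  have hGq' : dir ε G q = spaceDeriv N t₁ 0 e := hGsp.self_of_nhds e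
  have hΨq : Ψ q = Φ H₀ := hΨe.self_of_nhds
  have hm := dir_metric hFs hGs hΨs hFt' hGF
  have hh := dir_secondForm hFs hGs hΨs hFt' hGG hGF hFee
  rw [hFq, hGq', hNe, inner_smul_left, hee1, hΨq] at hm
  rw [hGq', hNe, inner_smul_left, inner_smul_right, hee1, hΨq] at hh
  have hΨee : dir ε (dir ε Ψ) q = γ := by
    have h1 := hasTwoDeriv_line hΨs q ε
    refine (h1.unique (hΦH.congr ?_)).2.2
    have hc : Tendsto (fun s : ℝ => q + s • ε) (𝓝 0) (𝓝 q) := by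
      have : Continuous fun s : ℝ => q + s • ε := by fun_prop
      simpa using this.tendsto 0
    filter_upwards [hc.eventually hΨe] with s hs
    rw [hs]
    simp [hq, hε]
  set g : EuclideanSpace ℝ (Fin n) × ℝ → ℝ := fun x => inner ℝ (dir ε F x) (dir ε F x) with hgd
  set h : EuclideanSpace ℝ (Fin n) × ℝ → ℝ := fun x => inner ℝ (dir ε G x) (dir ε F x) with hhd
  have hgs : ContDiff ℝ ∞ g := (contDiff_dir hFs ε).inner ℝ (contDiff_dir hFs ε)
  have hhs : ContDiff ℝ ∞ h := (contDiff_dir hGs ε).inner ℝ (contDiff_dir hFs ε)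
  have hgq : g q = 1 := by simp only [hgd]; rw [hFq, hee1]
  have hhq : h q = φ t₁ := by
    simp only [hhd]; rw [hFq, hGq', hNe, inner_smul_left, hee1]; simp
  have hder := (hasDerivAt_prod_right (diffAt hhs q)).sub
    (hφ.mul (hasDerivAt_prod_right (diffAt hgs q)))
  have hfin := hasDerivAt_nonpos_of_left hder
    (by change h q - φ t₁ * g q = 0; rw [hhq, hgq]; ring) (by
      have hc : Tendsto (fun s => ((0 : EuclideanSpace ℝ (Fin n)), s)) (𝓝[<] t₁) (𝓝 q) :=
        ((Continuous.prodMk continuous_const continuous_id).tendsto t₁).mono_left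
          nhdsWithin_le_nhds
      filter_upwards [hpast, hc.eventually hFsp, hc.eventually hGsp] with s h1 h2 h3
      change 0 ≤ h (0, s) - φ s * g (0, s)
      simp only [hgd, hhd]
      rw [hε, h2, h3]
      exact sub_nonneg.2 h1)
  -- After substitution this reads γ + Φ(H₀) φ(t₁)² - d ≤ 0, and γ ≥ 0.
  change dir τ h q - (d * g q + φ t₁ * dir τ g q) ≤ 0 at hfin
  rw [hh, hm, hgq, hΨee] at hfin
  simp only [conj_trivial] at hfin
  linarith

end Touching

/-! ### Writing a flow as a graph -/

/-- An isometric parametrization of the hyperplane orthogonal to a unit vector. -/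
theorem exists_isometry_orthogonal {n : ℕ} {a : Ambient n} (ha : a ≠ 0) :
    ∃ L : EuclideanSpace ℝ (Fin n) →ₗᵢ[ℝ] Ambient n, (∀ v, inner ℝ (L v) a = 0) ∧
      ∀ w, inner ℝ w a = 0 → ∃ v, L v = w := by
  have : Fact (Module.finrank ℝ (Ambient n) = n + 1) := ⟨by simp⟩
  let b := OrthonormalBasis.fromOrthogonalSpanSingleton (𝕜 := ℝ) n ha
  refine ⟨((ℝ ∙ a)ᗮ).subtypeₗᵢ.comp b.repr.symm.toLinearIsometry, fun v => ?_, fun w hw => ?_⟩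
  · rw [real_inner_comm]
    exact Submodule.mem_orthogonal_singleton_iff_inner_right.1 (b.repr.symm v).2
  · refine ⟨b.repr ⟨w, Submodule.mem_orthogonal_singleton_iff_inner_right.2 ?_⟩, ?_⟩
    · rw [real_inner_comm, hw]
    · simp

section

variable {n : ℕ} {Φ : ℝ → ℝ} {T t₁ : ℝ} {U : Set (EuclideanSpace ℝ (Fin n))}
  {Y N : EuclideanSpace ℝ (Fin n) × ℝ → Ambient n}

/-- Smooth local inverse of a map with injective derivative. -/
theorem exists_smooth_local_inverse {G : EuclideanSpace ℝ (Fin n) → EuclideanSpace ℝ (Fin n)}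
    (hU : IsOpen U) (hG : ContDiffOn ℝ ∞ G U) {x : EuclideanSpace ℝ (Fin n)} (hx : x ∈ U)
    (hinj : Function.Injective (fderiv ℝ G x)) :
    ∃ (V : Set (EuclideanSpace ℝ (Fin n))) (ψ : EuclideanSpace ℝ (Fin n) → EuclideanSpace ℝ (Fin n)),
      IsOpen V ∧ G x ∈ V ∧ ψ (G x) = x ∧ ContDiffOn ℝ ∞ ψ V ∧ MapsTo ψ V U ∧
      (∀ y ∈ V, G (ψ y) = y) ∧ ∀ y ∈ V, Function.Injective (fderiv ℝ ψ y) := by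
  have hGx := hG.contDiffAt (hU.mem_nhds hx)
  let A : EuclideanSpace ℝ (Fin n) ≃L[ℝ] EuclideanSpace ℝ (Fin n) :=
    (LinearEquiv.ofInjectiveEndo (fderiv ℝ G x).toLinearMap hinj).toContinuousLinearEquiv
  have hA : (A : EuclideanSpace ℝ (Fin n) →L[ℝ] EuclideanSpace ℝ (Fin n)) = fderiv ℝ G x := by
    ext v : 1
    rfl
  have hd : HasFDerivAt G (A : EuclideanSpace ℝ (Fin n) →L[ℝ] EuclideanSpace ℝ (Fin n)) x := by
    rw [hA]; exact (hGx.differentiableAt (by simp)).hasFDerivAt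
  let e := hGx.toOpenPartialHomeomorph G hd (by simp)
  have hes : x ∈ e.source := hGx.mem_toOpenPartialHomeomorph_source hd (by simp)
  have hec : ∀ z, e z = G z := fun z => rfl
  -- Restricting to the open set where the derivative of G is invertible makes the local inverse
  -- smooth on all of V, not just at G x.
  set W : Set (EuclideanSpace ℝ (Fin n)) := U ∩ fderiv ℝ G ⁻¹' range
    (fun B : EuclideanSpace ℝ (Fin n) ≃L[ℝ] EuclideanSpace ℝ (Fin n) =>
      (B : EuclideanSpace ℝ (Fin n) →L[ℝ] EuclideanSpace ℝ (Fin n))) with hW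
  have hWo : IsOpen W := (hG.continuousOn_fderiv_of_isOpen hU
    (one_le_two.trans two_le_infty)).isOpen_inter_preimage hU ContinuousLinearEquiv.isOpen
  have hinv : ∀ y ∈ e.target ∩ e.symm ⁻¹' W, ∃ B : EuclideanSpace ℝ (Fin n) ≃L[ℝ] EuclideanSpace ℝ (Fin n),
      HasFDerivAt e (B : EuclideanSpace ℝ (Fin n) →L[ℝ] EuclideanSpace ℝ (Fin n)) (e.symm y) := by
    rintro y ⟨-, hyU, B, hB⟩
    refine ⟨B, ?_⟩
    have : HasFDerivAt G (fderiv ℝ G (e.symm y)) (e.symm y) :=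
      ((hG.contDiffAt (hU.mem_nhds hyU)).differentiableAt (by simp)).hasFDerivAt
    rw [← hB] at this
    exact this
  refine ⟨e.target ∩ e.symm ⁻¹' W, e.symm, e.isOpen_inter_preimage_symm hWo,
    ⟨e.map_source hes, ?_⟩, e.left_inv hes, ?_, fun y hy => hy.2.1, fun y hy => e.right_inv hy.1, ?_⟩
  · change e.symm (e x) ∈ W
    rw [e.left_inv hes]
    exact ⟨hx, A, hA⟩
  · intro y hy
    obtain ⟨B, hB⟩ := hinv y hy
    exact (e.contDiffAt_symm hy.1 hB (hG.contDiffAt (hU.mem_nhds hy.2.1))).contDiffWithinAt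
  · intro y hy
    obtain ⟨B, hB⟩ := hinv y hy
    rw [(e.hasFDerivAt_symm hy.1 hB).fderiv]
    exact B.symm.injective

/-- Near any point, a local flow can be written as a graph over its tangent plane. -/
theorem IsLocalFlow.exists_graph (hf : IsLocalFlow Φ T U Y N) (ht₁ : t₁ ∈ Ico 0 T)
    {x : EuclideanSpace ℝ (Fin n)} (hx : x ∈ U) :
    ∃ (V : Set (EuclideanSpace ℝ (Fin n))) (ψ : EuclideanSpace ℝ (Fin n) → EuclideanSpace ℝ (Fin n))
      (L : EuclideanSpace ℝ (Fin n) →ₗᵢ[ℝ] Ambient n) (u : EuclideanSpace ℝ (Fin n) → ℝ),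
      IsOpen V ∧ ContDiffOn ℝ ∞ ψ V ∧ MapsTo ψ V U ∧
      (∀ y ∈ V, Function.Injective (fderiv ℝ ψ y)) ∧ ψ 0 = x ∧
      IsGraphAt t₁ V (fun q => Y (ψ q.1, q.2)) (fun q => N (ψ q.1, q.2)) (Y (x, t₁)) L u := by
  set a := N (x, t₁) with ha
  have ha1 : ‖a‖ = 1 := hf.norm_normal t₁ ht₁ x hx
  have haa : inner ℝ a a = (1 : ℝ) := by rw [real_inner_self_eq_norm_sq, ha1, one_pow]
  obtain ⟨L, hL, hL'⟩ := exists_isometry_orthogonal (a := a) (by rw [← norm_ne_zero_iff, ha1]; simp)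
  set P := L.toContinuousLinearMap.adjoint with hP
  have hPL : ∀ v, P (L v) = v := fun v => ext_inner_right ℝ fun w => by
    rw [hP, ContinuousLinearMap.adjoint_inner_left]
    exact L.inner_map_map v w
  have hdec : ∀ z, z = L (P z) + (inner ℝ z a : ℝ) • a := by
    intro z
    obtain ⟨v, hv⟩ := hL' (z - (inner ℝ z a : ℝ) • a) (by
      rw [inner_sub_left, inner_smul_left, haa]; simp)
    have hPa : P a = 0 := ext_inner_right ℝ fun w => by
      rw [hP, ContinuousLinearMap.adjoint_inner_left, inner_zero_left, real_inner_comm]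
      exact hL w
    have h1 : P z = v := by
      have := congrArg P hv
      rw [hPL, map_sub, map_smul, hPa, smul_zero, sub_zero] at this
      exact this.symm
    rw [h1, hv, sub_add_cancel]
  have hYs : ContDiffOn ℝ ∞ (fun y => Y (y, t₁) - Y (x, t₁)) U :=
    (contDiffOn_slice hf.smooth ht₁).sub contDiffOn_const
  -- The tangential projection of Y - Y(x). Its derivative at x is injective because ∂Y(x) is
  -- already tangential; the local inverse ψ then gives graph coordinates.
  set G : EuclideanSpace ℝ (Fin n) → EuclideanSpace ℝ (Fin n) :=
    fun y => P (Y (y, t₁) - Y (x, t₁)) with hG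
  have hGs : ContDiffOn ℝ ∞ G U := P.contDiff.comp_contDiffOn hYs
  have hGd : fderiv ℝ G x = P.comp (spaceDeriv Y t₁ x) := by
    have h1 := ((contDiffOn_slice hf.smooth ht₁).contDiffAt
      (hf.isOpen.mem_nhds hx)).differentiableAt (by simp)
    exact (P.hasFDerivAt.comp x (h1.hasFDerivAt.sub_const (Y (x, t₁)))).fderiv
  have hinj : Function.Injective (fderiv ℝ G x) := by
    rw [hGd]
    refine (injective_iff_map_eq_zero _).2 fun v hv => hf.injective t₁ ht₁ x hx ?_
    rw [map_zero, hdec (spaceDeriv Y t₁ x v), real_inner_comm, hf.inner_normal t₁ ht₁ x hx,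
      zero_smul, add_zero]
    rw [ContinuousLinearMap.comp_apply] at hv
    rw [hv, map_zero]
  obtain ⟨V, ψ, hVo, h0V, hψ0, hψs, hψm, hGψ, hψi⟩ :=
    exists_smooth_local_inverse hf.isOpen hGs hx hinj
  have hG0 : G x = 0 := by simp [hG]
  rw [hG0] at h0V hψ0
  have hus : ContDiffOn ℝ ∞ (fun y => -(inner ℝ (Y (ψ y, t₁) - Y (x, t₁)) a : ℝ)) V :=
    ((hYs.comp hψs hψm).inner ℝ contDiffOn_const).neg
  obtain ⟨u, hu, hue⟩ := exists_contDiff_eventuallyEq hVo hus h0V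
  obtain ⟨V', hV'sub, hV'o, h0V'⟩ := mem_nhds_iff.1 (inter_mem (hVo.mem_nhds h0V) hue)
  have hV'V : V' ⊆ V := fun y hy => (hV'sub hy).1
  refine ⟨V', ψ, L, u, hV'o, hψs.mono hV'V, fun y hy => hψm (hV'V hy),
    fun y hy => hψi y (hV'V hy), hψ0, h0V', hu, ?_, ?_, ?_⟩
  · intro y hy
    have h1 := hdec (Y (ψ y, t₁) - Y (x, t₁))
    have h2 : P (Y (ψ y, t₁) - Y (x, t₁)) = y := hGψ y (hV'V hy)
    have h3 : u y = -(inner ℝ (Y (ψ y, t₁) - Y (x, t₁)) a : ℝ) := (hV'sub hy).2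
    rw [h2] at h1
    simp only [hψ0]
    rw [h3, neg_smul, sub_neg_eq_add, add_assoc, ← h1]
    abel
  · simpa only [hψ0] using hL
  · simpa only [hψ0] using hL'

/-- The maximum principle at a touching point of a local flow. -/
theorem IsLocalFlow.touching (hΦ : ContDiffOn ℝ ∞ Φ (Ioi 0))
    (hΦ' : ∀ x ∈ Ioi (0 : ℝ), 0 < deriv Φ x)
    (hΦ'' : ∀ x ∈ Ioi (0 : ℝ), -2 * deriv Φ x / x ≤ deriv (deriv Φ) x)
    (hf : IsLocalFlow Φ T U Y N) (ht₁ : t₁ ∈ Ioo 0 T) {x : EuclideanSpace ℝ (Fin n)} (hx : x ∈ U)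
    {φ : ℝ → ℝ} {d : ℝ} (hlam : 0 < φ t₁) (hφ : HasDerivAt φ d t₁)
    (hmin : ∀ y ∈ U, ∀ v, φ t₁ * inner ℝ (spaceDeriv Y t₁ y v) (spaceDeriv Y t₁ y v) ≤
      inner ℝ (spaceDeriv N t₁ y v) (spaceDeriv Y t₁ y v))
    {e : EuclideanSpace ℝ (Fin n)} (he0 : e ≠ 0)
    (hee : inner ℝ (spaceDeriv N t₁ x e) (spaceDeriv Y t₁ x e) =
      φ t₁ * inner ℝ (spaceDeriv Y t₁ x e) (spaceDeriv Y t₁ x e))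
    (hpast : ∀ᶠ t in 𝓝[<] t₁, φ t * inner ℝ (spaceDeriv Y t x e) (spaceDeriv Y t x e) ≤
      inner ℝ (spaceDeriv N t x e) (spaceDeriv Y t x e)) :
    φ t₁ ≤ localCurvature Y N t₁ x ∧ Φ (localCurvature Y N t₁ x) * φ t₁ ^ 2 ≤ d := by
  have ht₁' : t₁ ∈ Ico 0 T := ⟨ht₁.1.le, ht₁.2⟩
  obtain ⟨V, ψ, L, u, hVo, hψs, hψU, hψi, hψ0, hg⟩ := hf.exists_graph ht₁' hx
  obtain ⟨hfV, hder⟩ := hf.comp hVo hψs hψU hψi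
  have h0V := hg.zero_mem
  obtain ⟨e₁, he₁⟩ : ∃ e₁, fderiv ℝ ψ 0 e₁ = e :=
    LinearMap.surjective_of_injective (f := (fderiv ℝ ψ 0).toLinearMap) (hψi 0 h0V) e
  have he₁0 : e₁ ≠ 0 := by rintro rfl; exact he0 (by rw [← he₁, map_zero])
  set k := ‖e₁‖⁻¹ with hk
  have hk0 : 0 < k := by positivity
  have hYe : ∀ t ∈ Ico 0 T, spaceDeriv (fun q => Y (ψ q.1, q.2)) t 0 (k • e₁) =
      k • spaceDeriv Y t x e := by
    intro t ht
    rw [(hder t ht 0 h0V).1, map_smul, ContinuousLinearMap.comp_apply, he₁, hψ0]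
  have hNe : ∀ t ∈ Ico 0 T, spaceDeriv (fun q => N (ψ q.1, q.2)) t 0 (k • e₁) =
      k • spaceDeriv N t x e := by
    intro t ht
    rw [(hder t ht 0 h0V).2, map_smul, ContinuousLinearMap.comp_apply, he₁, hψ0]
  have hH : localCurvature (fun q => Y (ψ q.1, q.2)) (fun q => N (ψ q.1, q.2)) t₁ 0 =
      localCurvature Y N t₁ x := by
    rw [localCurvature, (hder t₁ ht₁' 0 h0V).1, (hder t₁ ht₁' 0 h0V).2,
      trace_gram_comp _ _ _ (hψi 0 h0V), hψ0]
    rfl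
  rw [← hH]
  refine hg.touching hΦ hΦ' hΦ'' hfV ht₁ hlam hφ (fun y hy v => ?_) (e := k • e₁) ?_ ?_ ?_
  · rw [(hder t₁ ht₁' y hy).1, (hder t₁ ht₁' y hy).2]
    exact hmin _ (hψU hy) _
  · rw [norm_smul, hk, norm_inv, norm_norm, inv_mul_cancel₀ (norm_ne_zero_iff.2 he₁0)]
  · rw [hYe t₁ ht₁', hNe t₁ ht₁']
    simp only [inner_smul_left, inner_smul_right, hee]
    ring
  · filter_upwards [hpast, nhdsWithin_le_nhds (Ioo_mem_nhds ht₁.1 ht₁.2)] with t ht ht'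
    have ht'' := Ioo_subset_Ico_self ht'
    rw [hYe t ht'', hNe t ht'']
    simp only [inner_smul_left, inner_smul_right, conj_trivial]
    have := mul_le_mul_of_nonneg_left ht (mul_self_nonneg k)
    linarith

end

/-! ### First touching times and the growth of the speed near 0 -/

/-- A continuous barrier below a lower semicontinuous function at time `s` and not below at time
`t` is first touched at some time in between. -/
theorem exists_first_touch {f φ : ℝ → ℝ} {T s t : ℝ} (hs : 0 ≤ s) (ht : t < T)
    (hf : ∀ r ∈ Ico 0 T, ∀ c < f r, ∀ᶠ r' in 𝓝[Ico 0 T] r, c < f r') (hφ : Continuous φ)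
    (hst : s ≤ t) (h0 : φ s < f s) (h1 : f t ≤ φ t) :
    ∃ r ∈ Ioc s t, f r ≤ φ r ∧ ∀ r' ∈ Ico s r, φ r' < f r' := by
  -- Lower semicontinuity of f makes A closed, so A has a least element.
  set A := {r ∈ Icc s t | f r ≤ φ r} with hA
  have hcl : IsClosed A := by
    refine isClosed_of_closure_subset fun r hr => ?_
    have hrI : r ∈ Icc s t := closure_minimal (fun _ h => h.1) isClosed_Icc hr
    refine ⟨hrI, ?_⟩
    by_contra! hlt
    obtain ⟨c, hc1, hc2⟩ := exists_between hlt
    have h2 := eventually_nhdsWithin_iff.1 (hf r ⟨hs.trans hrI.1, hrI.2.trans_lt ht⟩ c hc2)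
    have h3 : ∀ᶠ r' in 𝓝 r, φ r' < c := hφ.continuousAt.eventually_lt_const hc1
    obtain ⟨r', hr', h4, h5⟩ := (mem_closure_iff_frequently.1 hr).and_eventually (h2.and h3) |>.exists
    exact absurd hr'.2 (not_le.2 (h5.trans (h4 ⟨hs.trans hr'.1.1, hr'.1.2.trans_lt ht⟩)))
  have hne : A.Nonempty := ⟨t, ⟨hst, le_rfl⟩, h1⟩
  obtain ⟨r, hr, hmin⟩ := (isCompact_Icc.of_isClosed_subset hcl fun _ h => h.1).exists_isLeast hne
  refine ⟨r, ⟨lt_of_le_of_ne hr.1.1 ?_, hr.1.2⟩, hr.2, fun r' hr' => ?_⟩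
  · rintro rfl
    exact absurd hr.2 (not_le.2 h0)
  · by_contra! h
    exact absurd (hmin ⟨⟨hr'.1, hr'.2.le.trans hr.1.2⟩, h⟩) (not_le.2 hr'.2)

/-- The lower bound for the speed which keeps the curvature positive. -/
theorem exists_speed_lower_bound {Φ : ℝ → ℝ} (hΦ : ContDiffOn ℝ ∞ Φ (Ioi 0))
    (hΦ' : ∀ x ∈ Ioi (0 : ℝ), 0 < deriv Φ x)
    (hΦ'' : ∀ x ∈ Ioi (0 : ℝ), -2 * deriv Φ x / x ≤ deriv (deriv Φ) x) {c : ℝ} (hc : 0 < c) :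
    ∃ K, ∀ x, 0 < x → x ≤ c → ∀ l, 0 < l → l ≤ x → -K * l ≤ Φ x * l ^ 2 := by
  have hd : ∀ x, 0 < x → HasDerivAt Φ (deriv Φ x) x := fun x hx =>
    ((hΦ.contDiffAt (isOpen_Ioi.mem_nhds hx)).differentiableAt (by simp)).hasDerivAt
  have hdd : ∀ x, 0 < x → HasDerivAt (deriv Φ) (deriv (deriv Φ) x) x := fun x hx => by
    have h1 := hΦ.deriv_of_isOpen (m := 1) isOpen_Ioi (by norm_num; exact two_le_infty)
    exact ((h1.contDiffAt (isOpen_Ioi.mem_nhds hx)).differentiableAt (by simp)).hasDerivAt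
  -- The derivative is x²(Φ'' + 2Φ'/x), nonnegative by hypothesis.
  have hm : MonotoneOn (fun x => x ^ 2 * deriv Φ x) (Ioi 0) := by
    have hh : ∀ x, 0 < x → HasDerivAt (fun x => x ^ 2 * deriv Φ x)
        (2 * x * deriv Φ x + x ^ 2 * deriv (deriv Φ) x) x := fun x hx => by
      exact ((hasDerivAt_pow 2 x).mul (hdd x hx)).congr_deriv (by simp)
    refine monotoneOn_of_deriv_nonneg (convex_Ioi 0)
      (fun x hx => (hh x hx).continuousAt.continuousWithinAt)
      (fun x hx => ?_) fun x hx => ?_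
    · rw [interior_Ioi] at hx
      exact (hh x hx).differentiableAt.differentiableWithinAt
    · rw [interior_Ioi] at hx
      have hx' : 0 < x := hx
      rw [(hh x hx).deriv]
      have h1 := mul_le_mul_of_nonneg_left (hΦ'' x hx) (sq_nonneg x)
      have h2 : x ^ 2 * (-2 * deriv Φ x / x) = -(2 * x * deriv Φ x) := by
        field_simp
      linarith
  set K₀ := c ^ 2 * deriv Φ c with hK₀
  have hK₀pos : 0 < K₀ := mul_pos (by positivity) (hΦ' c hc)
  -- On (0, c] the preceding monotonicity gives Φ' ≤ K₀ / x².
  have ha : AntitoneOn (fun x => Φ x + K₀ * x⁻¹) (Ioc 0 c) := by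
    have hh : ∀ x, 0 < x → HasDerivAt (fun x => Φ x + K₀ * x⁻¹)
        (deriv Φ x + K₀ * -(x ^ 2)⁻¹) x := fun x hx =>
      (hd x hx).add ((hasDerivAt_inv hx.ne').const_mul K₀)
    refine antitoneOn_of_deriv_nonpos (convex_Ioc 0 c)
      (fun x hx => (hh x hx.1).continuousAt.continuousWithinAt)
      (fun x hx => ?_) fun x hx => ?_
    · rw [interior_Ioc] at hx
      exact (hh x hx.1).differentiableAt.differentiableWithinAt
    · rw [interior_Ioc] at hx
      rw [(hh x hx.1).deriv]
      have h1 : x ^ 2 * deriv Φ x ≤ K₀ := hm hx.1 hc hx.2.le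
      have h2 : 0 < x ^ 2 := pow_pos hx.1 2
      have h3 : deriv Φ x ≤ K₀ * (x ^ 2)⁻¹ := by
        rw [← div_eq_mul_inv, le_div_iff₀ h2, mul_comm]
        exact h1
      linarith
  -- Multiply Φ(x) ≥ -|Φ(c)| - K₀/x by l² and use l ≤ x ≤ c.
  refine ⟨|Φ c| * c + K₀, fun x hx hxc l hl hlx => ?_⟩
  have h1 : Φ c + K₀ * c⁻¹ ≤ Φ x + K₀ * x⁻¹ := ha ⟨hx, hxc⟩ ⟨hc, le_rfl⟩ hxc
  have h2 : -|Φ c| - K₀ * x⁻¹ ≤ Φ x := by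
    have := neg_abs_le (Φ c)
    have : 0 < K₀ * c⁻¹ := by positivity
    linarith
  have h3 := mul_le_mul_of_nonneg_right h2 (sq_nonneg l)
  have h4 : x⁻¹ * l ≤ 1 := by
    rw [inv_mul_le_iff₀ hx]; linarith
  have h5 : K₀ * (x⁻¹ * l) * l ≤ K₀ * 1 * l := by gcongr
  have h6 : |Φ c| * l * l ≤ |Φ c| * c * l := by
    have := hlx.trans hxc
    gcongr
  linarith

/-! ### The least principal curvature of the whole hypersurface -/

section Global

variable {n : ℕ} {M : Type*} [TopologicalSpace M] [ChartedSpace (EuclideanSpace ℝ (Fin n)) M]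
  {Φ : ℝ → ℝ} {T : ℝ} {X ν : ℝ → M → Ambient n}

namespace IsFlow

theorem tendsto_chart (p : M) (t : ℝ) :
    Tendsto (fun q : M × ℝ => (extChartAt (𝓡 n) p q.1, q.2)) (𝓝[univ ×ˢ Ico 0 T] (p, t))
      (𝓝[(extChartAt (𝓡 n) p).target ×ˢ Ico 0 T] (extChartAt (𝓡 n) p p, t)) := by
  refine tendsto_nhdsWithin_iff.2 ⟨?_, ?_⟩
  · have h1 : ContinuousAt (fun q : M × ℝ => (extChartAt (𝓡 n) p q.1, q.2)) (p, t) :=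
      ((continuousAt_extChartAt (I := 𝓡 n) p).comp (f := Prod.fst) (x := (p, t))
        continuousAt_fst).prodMk continuousAt_snd
    exact h1.mono_left nhdsWithin_le_nhds
  · have h2 : ∀ᶠ q : M × ℝ in 𝓝 (p, t), q.1 ∈ (extChartAt (𝓡 n) p).source :=
      continuousAt_fst.eventually (extChartAt_source_mem_nhds (I := 𝓡 n) p)
    filter_upwards [nhdsWithin_le_nhds h2, self_mem_nhdsWithin] with q h3 h4
    exact ⟨(extChartAt (𝓡 n) p).map_source h3, h4.2⟩

theorem eventually_source (p : M) (t : ℝ) (S : Set (M × ℝ)) :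
    ∀ᶠ q : M × ℝ in 𝓝[S] (p, t), q.1 ∈ (extChartAt (𝓡 n) p).source :=
  nhdsWithin_le_nhds (continuousAt_fst.eventually (extChartAt_source_mem_nhds (I := 𝓡 n) p))

theorem metric_pos (hflow : IsFlow Φ T X ν) {t : ℝ} (ht : t ∈ Ico 0 T) (p : M)
    {v : EuclideanSpace ℝ (Fin n)} (hv : v ≠ 0) :
    (0 : ℝ) < inner ℝ (tangentMap (X t) p v) (tangentMap (X t) p v) :=
  real_inner_self_pos.2 fun h => hv 
    (hflow.immersion t ht p (h.trans (map_zero (tangentMap (X t) p)).symm))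

theorem isPrincipalCurvature_iff (hflow : IsFlow Φ T X ν) {t : ℝ} (ht : t ∈ Ico 0 T) (p : M)
    (κ : ℝ) : IsPrincipalCurvature (X t) (ν t) p κ ↔ ∃ v, v ≠ 0 ∧ ∀ w,
      inner ℝ (tangentMap (ν t) p w) (tangentMap (X t) p v) =
        κ * inner ℝ (tangentMap (X t) p w) (tangentMap (X t) p v) :=
  hasEigenvalue_iff (hflow.immersion t ht p) κ

theorem le_of_isPrincipalCurvature (hflow : IsFlow Φ T X ν) {t : ℝ} (ht : t ∈ Ico 0 T) {c κ : ℝ}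
    {p : M} (hc : ∀ v, c * inner ℝ (tangentMap (X t) p v) (tangentMap (X t) p v) ≤
      inner ℝ (tangentMap (ν t) p v) (tangentMap (X t) p v))
    (hκ : IsPrincipalCurvature (X t) (ν t) p κ) : c ≤ κ := by
  obtain ⟨v, hv, h⟩ := (hflow.isPrincipalCurvature_iff ht p κ).1 hκ
  have h1 := hc v
  rw [h v] at h1
  exact le_of_mul_le_mul_right h1 (hflow.metric_pos ht p hv)

variable [IsManifold (𝓡 n) ∞ M]

theorem symm (hflow : IsFlow Φ T X ν) {t : ℝ} (ht : t ∈ Ico 0 T) (p : M)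
    (v w : EuclideanSpace ℝ (Fin n)) :
    inner ℝ (tangentMap (ν t) p v) (tangentMap (X t) p w) =
      (inner ℝ (tangentMap (ν t) p w) (tangentMap (X t) p v) : ℝ) := by
  obtain ⟨hf, hJ⟩ := hflow.local p
  have hy := mem_extChartAt_target (I := 𝓡 n) p
  obtain ⟨J, hJ⟩ := hJ _ hy
  have h := hf.symm ht hy (J.symm v) (J.symm w)
  rw [(hJ t ht).1, (hJ t ht).2.1] at h
  simpa using h

/-- Positivity of `h - c g` is an open condition. -/
theorem eventually_pos (hflow : IsFlow Φ T X ν) {t : ℝ} (ht : t ∈ Ico 0 T) (p : M) {c : ℝ}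
    (hc : ∀ v, v ≠ 0 → c * inner ℝ (tangentMap (X t) p v) (tangentMap (X t) p v) <
      inner ℝ (tangentMap (ν t) p v) (tangentMap (X t) p v)) :
    ∀ᶠ q in 𝓝[univ ×ˢ Ico 0 T] (p, t), ∀ v, v ≠ 0 →
      c * inner ℝ (tangentMap (X q.2) q.1 v) (tangentMap (X q.2) q.1 v) <
        inner ℝ (tangentMap (ν q.2) q.1 v) (tangentMap (X q.2) q.1 v) := by
  obtain ⟨hf, hJ⟩ := hflow.local p
  have hy := mem_extChartAt_target (I := 𝓡 n) p
  have h1 := hf.eventually_pos ht hy (c := c) (by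
    intro v hv
    obtain ⟨J, hJ⟩ := hJ _ hy
    rw [(hJ t ht).1, (hJ t ht).2.1, extChartAt_to_inv]
    exact hc (J v) (by simpa using hv))
  filter_upwards [(tendsto_chart (n := n) p t).eventually h1, eventually_source (n := n) p t _,
    self_mem_nhdsWithin] with q h2 h3 h4 v hv
  obtain ⟨J, hJ⟩ := hJ _ ((extChartAt (𝓡 n) p).map_source h3)
  have h5 := h2 (J.symm v) (by simpa using hv)
  rw [(hJ q.2 h4.2).1, (hJ q.2 h4.2).2.1, (extChartAt (𝓡 n) p).left_inv h3] at h5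
  simpa using h5

theorem continuousOn_meanCurvature (hflow : IsFlow Φ T X ν) :
    ContinuousOn (fun q : M × ℝ => meanCurvature (X q.2) (ν q.2) q.1) (univ ×ˢ Ico 0 T) := by
  rintro ⟨p, t⟩ ht
  obtain ⟨hf, hJ⟩ := hflow.local p
  have hy := mem_extChartAt_target (I := 𝓡 n) p
  have h1 := hf.continuousOn_localCurvature (extChartAt (𝓡 n) p p, t) ⟨hy, ht.2⟩
  have h2 := h1.tendsto.comp (tendsto_chart (n := n) p t)
  have key : ∀ q : M × ℝ, q.1 ∈ (extChartAt (𝓡 n) p).source → q.2 ∈ Ico 0 T →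
      localCurvature (fun q => X q.2 ((extChartAt (𝓡 n) p).symm q.1))
        (fun q => ν q.2 ((extChartAt (𝓡 n) p).symm q.1)) q.2 (extChartAt (𝓡 n) p q.1) =
        meanCurvature (X q.2) (ν q.2) q.1 := by
    intro q h3 h4
    obtain ⟨J, hJ⟩ := hJ _ ((extChartAt (𝓡 n) p).map_source h3)
    rw [(hJ q.2 h4).2.2, (extChartAt (𝓡 n) p).left_inv h3]
  rw [key (p, t) (mem_extChartAt_source p) ht.2] at h2
  refine h2.congr' ?_
  filter_upwards [eventually_source (n := n) p t _, self_mem_nhdsWithin] with q h3 h4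
  exact key q h3 h4.2

theorem continuousOn_forms (hflow : IsFlow Φ T X ν) (p : M) (v : EuclideanSpace ℝ (Fin n)) :
    ContinuousOn (fun t => tangentMap (X t) p v) (Ico 0 T) ∧
      ContinuousOn (fun t => tangentMap (ν t) p v) (Ico 0 T) := by
  obtain ⟨hf, hJ⟩ := hflow.local p
  have hy := mem_extChartAt_target (I := 𝓡 n) p
  obtain ⟨J, hJ⟩ := hJ _ hy
  have hline : ContinuousOn (fun t : ℝ => (extChartAt (𝓡 n) p p, t)) (Ico 0 T) := by fun_prop
  have h1 := (continuousOn_spaceDeriv hf.isOpen hf.smooth).comp hline fun t ht => ⟨hy, ht⟩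
  have h2 := (continuousOn_spaceDeriv hf.isOpen hf.smooth_normal).comp hline fun t ht => ⟨hy, ht⟩
  refine ⟨(h1.clm_apply (continuousOn_const (c := J.symm v))).congr fun t ht => ?_,
    (h2.clm_apply (continuousOn_const (c := J.symm v))).congr fun t ht => ?_⟩
  · simp only [Function.comp]
    rw [(hJ t ht).1, extChartAt_to_inv]
    simp
  · simp only [Function.comp]
    rw [(hJ t ht).2.1, extChartAt_to_inv]
    simp

variable [CompactSpace M] [Nonempty M]

/-- The pointwise least principal curvature is lower semicontinuous, since positivity of h - c g is
open, so it attains its minimum on the compact M. -/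
theorem exists_min (hflow : IsFlow Φ T X ν) (hn : 0 < n) {t : ℝ} (ht : t ∈ Ico 0 T) :
    ∃ κ, (∀ p v, κ * inner ℝ (tangentMap (X t) p v) (tangentMap (X t) p v) ≤
      inner ℝ (tangentMap (ν t) p v) (tangentMap (X t) p v)) ∧
      ∃ p, IsPrincipalCurvature (X t) (ν t) p κ := by
  choose κ hκ v hv hκv using fun p => exists_min_eigenvector hn (hflow.immersion t ht p)
    (hflow.symm ht p)
  have hlsc : LowerSemicontinuousOn κ univ := by
    intro p _ c hc
    have h1 := hflow.eventually_pos ht p (c := c) fun w hw =>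
      (mul_lt_mul_of_pos_right hc (hflow.metric_pos ht p hw)).trans_le (hκ p w)
    have hc : Tendsto (fun p' : M => (p', t)) (𝓝[univ] p) (𝓝[univ ×ˢ Ico 0 T] (p, t)) := by
      refine tendsto_nhdsWithin_iff.2 ⟨?_, .of_forall fun p' => ⟨mem_univ _, ht⟩⟩
      exact ((Continuous.prodMk continuous_id continuous_const).tendsto p).mono_left
        nhdsWithin_le_nhds
    filter_upwards [hc.eventually h1] with p' h2
    have h3 := h2 (v p') (hv p')
    rw [hκv p' (v p')] at h3
    exact lt_of_mul_lt_mul_right h3 (hflow.metric_pos ht p' (hv p')).le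
  obtain ⟨p, -, hp⟩ := hlsc.exists_isMinOn univ_nonempty isCompact_univ
  refine ⟨κ p, fun p' w => le_trans ?_ (hκ p' w), p, (hflow.isPrincipalCurvature_iff ht p _).2
    ⟨v p, hv p, hκv p⟩⟩
  exact mul_le_mul_of_nonneg_right (hp (mem_univ p')) real_inner_self_nonneg

theorem lambdaMin_spec (hflow : IsFlow Φ T X ν) (hn : 0 < n) {t : ℝ} (ht : t ∈ Ico 0 T) :
    IsLeast (principalCurvatures (X t) (ν t)) (lambdaMin (X t) (ν t)) ∧
    ∀ p v, lambdaMin (X t) (ν t) * inner ℝ (tangentMap (X t) p v) (tangentMap (X t) p v) ≤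
      inner ℝ (tangentMap (ν t) p v) (tangentMap (X t) p v) := by
  obtain ⟨κ, h1, h2⟩ := hflow.exists_min hn ht
  have h3 : IsLeast (principalCurvatures (X t) (ν t)) κ :=
    ⟨h2, fun κ' ⟨p, hp⟩ => hflow.le_of_isPrincipalCurvature ht (h1 p) hp⟩
  have h4 : lambdaMin (X t) (ν t) = κ := h3.csInf_eq
  rw [h4]
  exact ⟨h3, h1⟩

theorem strictlyConvex_iff (hflow : IsFlow Φ T X ν) (hn : 0 < n) {t : ℝ} (ht : t ∈ Ico 0 T) :
    StrictlyConvex (X t) (ν t) ↔ 0 < lambdaMin (X t) (ν t) := by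
  obtain ⟨⟨⟨p, hp⟩, hle⟩, -⟩ := hflow.lambdaMin_spec hn ht
  exact ⟨fun h => h p _ hp, fun h p κ hκ => h.trans_le (hle ⟨p, hκ⟩)⟩

/-- Positivity of h - c g is open in (p, t), and compactness of M makes the time neighbourhood
uniform in p. -/
theorem eventually_lt_lambdaMin (hflow : IsFlow Φ T X ν) (hn : 0 < n) {t : ℝ} (ht : t ∈ Ico 0 T)
    {c : ℝ} (hc : c < lambdaMin (X t) (ν t)) :
    ∀ᶠ t' in 𝓝[Ico 0 T] t, c < lambdaMin (X t') (ν t') := by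
  have h1 : ∀ᶠ t' in 𝓝 t, ∀ p ∈ (univ : Set M), t' ∈ Ico 0 T → ∀ v, v ≠ 0 →
      c * inner ℝ (tangentMap (X t') p v) (tangentMap (X t') p v) <
        inner ℝ (tangentMap (ν t') p v) (tangentMap (X t') p v) := by
    refine isCompact_univ.eventually_forall_of_forall_eventually fun p _ => ?_
    have h2 := eventually_nhdsWithin_iff.1 (hflow.eventually_pos ht p (c := c) fun w hw =>
      (mul_lt_mul_of_pos_right hc (hflow.metric_pos ht p hw)).trans_le
        ((hflow.lambdaMin_spec hn ht).2 p w))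
    filter_upwards [(continuous_swap.tendsto (t, p)).eventually h2] with z hz hz'
    exact hz ⟨mem_univ _, hz'⟩
  refine eventually_nhdsWithin_iff.2 ?_
  filter_upwards [h1] with t' h2 ht'
  obtain ⟨p, hp⟩ := (hflow.lambdaMin_spec hn ht').1.1
  obtain ⟨v, hv, h⟩ := (hflow.isPrincipalCurvature_iff ht' p _).1 hp
  have h3 := h2 p (mem_univ p) ht' v hv
  rw [h v] at h3
  exact lt_of_mul_lt_mul_right h3 (hflow.metric_pos ht' p hv).le

/-- The maximum principle for the smallest principal curvature, in barrier form. -/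
theorem touching (hΦ : ContDiffOn ℝ ∞ Φ (Ioi 0))
    (hΦ' : ∀ x ∈ Ioi (0 : ℝ), 0 < deriv Φ x)
    (hΦ'' : ∀ x ∈ Ioi (0 : ℝ), -2 * deriv Φ x / x ≤ deriv (deriv Φ) x)
    (hflow : IsFlow Φ T X ν) (hn : 0 < n) {t : ℝ} (ht : t ∈ Ioo 0 T) {φ : ℝ → ℝ} {d : ℝ}
    (hpos : 0 < φ t) (hφ : HasDerivAt φ d t) (hle : lambdaMin (X t) (ν t) ≤ φ t)
    (hpast : ∀ᶠ s in 𝓝[<] t, φ s ≤ lambdaMin (X s) (ν s)) :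
    ∃ p, φ t ≤ meanCurvature (X t) (ν t) p ∧ Φ (meanCurvature (X t) (ν t) p) * φ t ^ 2 ≤ d := by
  have ht' := Ioo_subset_Ico_self ht
  have hIoo : ∀ᶠ s in 𝓝[<] t, s ∈ Ico 0 T :=
    nhdsWithin_le_nhds (Ico_mem_nhds ht.1 ht.2)
  have hpast' : ∀ p v, ∀ᶠ s in 𝓝[<] t,
      φ s * inner ℝ (tangentMap (X s) p v) (tangentMap (X s) p v) ≤
        inner ℝ (tangentMap (ν s) p v) (tangentMap (X s) p v) := by
    intro p v
    filter_upwards [hpast, hIoo] with s h1 h2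
    exact (mul_le_mul_of_nonneg_right h1 real_inner_self_nonneg).trans
      ((hflow.lambdaMin_spec hn h2).2 p v)
  -- For fixed p and v the bound passes to the limit s → t from the left. Hence φ(t) ≤ `lambdaMin`
  -- at t, and `hle` gives equality.
  have hbound : ∀ p v, φ t * inner ℝ (tangentMap (X t) p v) (tangentMap (X t) p v) ≤
      inner ℝ (tangentMap (ν t) p v) (tangentMap (X t) p v) := by
    intro p v
    obtain ⟨h1, h2⟩ := hflow.continuousOn_forms p v
    have h1' := (h1.continuousAt (Ico_mem_nhds ht.1 ht.2)).mono_left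
      (nhdsWithin_le_nhds (s := Iio t))
    have h2' := (h2.continuousAt (Ico_mem_nhds ht.1 ht.2)).mono_left
      (nhdsWithin_le_nhds (s := Iio t))
    have h3 := hφ.continuousAt.mono_left (nhdsWithin_le_nhds (s := Iio t))
    exact le_of_tendsto_of_tendsto (h3.mul (h1'.inner h1')) (h2'.inner h1') (hpast' p v)
  obtain ⟨p, hp⟩ := (hflow.lambdaMin_spec hn ht').1.1
  have heq : lambdaMin (X t) (ν t) = φ t :=
    le_antisymm hle (hflow.le_of_isPrincipalCurvature ht' (hbound p) hp)
  obtain ⟨v, hv, hv'⟩ := (hflow.isPrincipalCurvature_iff ht' p _).1 hp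
  rw [heq] at hv'
  obtain ⟨hf, hJ⟩ := hflow.local p
  have hy := mem_extChartAt_target (I := 𝓡 n) p
  obtain ⟨J, hJp⟩ := hJ _ hy
  rw [extChartAt_to_inv] at hJp
  refine ⟨p, ?_⟩
  rw [← (hJp t ht').2.2]
  refine hf.touching hΦ hΦ' hΦ'' ht hy hpos hφ (fun y hy v => ?_) (e := J.symm v)
    (by simpa using hv) ?_ ?_
  · obtain ⟨J', hJ'⟩ := hJ y hy
    rw [(hJ' t ht').1, (hJ' t ht').2.1]
    exact hbound _ _
  · rw [(hJp t ht').1, (hJp t ht').2.1]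
    simpa using hv' v
  · filter_upwards [hpast' p v, hIoo] with s h1 h2
    rw [(hJp s h2).1, (hJp s h2).2.1]
    simpa using h1

theorem lambdaMin_pos (hΦ : ContDiffOn ℝ ∞ Φ (Ioi 0))
    (hΦ' : ∀ x ∈ Ioi (0 : ℝ), 0 < deriv Φ x)
    (hΦ'' : ∀ x ∈ Ioi (0 : ℝ), -2 * deriv Φ x / x ≤ deriv (deriv Φ) x)
    (hflow : IsFlow Φ T X ν) (hn : 0 < n) (h0 : 0 < lambdaMin (X 0) (ν 0)) {t : ℝ}
    (ht : t ∈ Ico 0 T) : 0 < lambdaMin (X t) (ν t) := by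
  by_contra! hneg
  have hK : IsCompact ((univ : Set M) ×ˢ Icc 0 t) := isCompact_univ.prod isCompact_Icc
  obtain ⟨C, hC⟩ := hK.bddAbove_image
    (hflow.continuousOn_meanCurvature.mono (prod_mono_right (Icc_subset_Ico_right ht.2)))
  obtain ⟨K, hK⟩ := exists_speed_lower_bound hΦ hΦ' hΦ'' (c := max C 1) (by positivity)
  set l₀ := lambdaMin (X 0) (ν 0)
  -- The factor 1/2 puts the barrier strictly below `lambdaMin` at time 0. Touching would give Φ(H)
  -- φ² ≤ -(K + 1) φ, against Φ(H) φ² ≥ -K φ, which holds because φ ≤ H ≤ max C 1.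
  set φ : ℝ → ℝ := fun s => l₀ / 2 * Real.exp (-(K + 1) * s) with hφ
  have hφpos : ∀ s, 0 < φ s := fun s => by positivity
  have hφd : ∀ s, HasDerivAt φ (-(K + 1) * φ s) s := by
    intro s
    have := (((hasDerivAt_id s).const_mul (-(K + 1))).exp).const_mul (l₀ / 2)
    refine this.congr_deriv ?_
    simp only [hφ, id]
    ring
  obtain ⟨r, hr, hr1, hr2⟩ := exists_first_touch (f := fun s => lambdaMin (X s) (ν s)) (φ := φ)
    le_rfl ht.2 (fun r hr c hc => hflow.eventually_lt_lambdaMin hn hr hc)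
    (by fun_prop) ht.1 (by simp only [hφ, mul_zero, Real.exp_zero]; linarith)
    (hneg.trans (hφpos t).le)
  obtain ⟨p, hp1, hp2⟩ := touching hΦ hΦ' hΦ'' hflow hn ⟨hr.1, hr.2.trans_lt ht.2⟩ (hφpos r) (hφd r) hr1
    (by filter_upwards [Ioo_mem_nhdsLT hr.1] with s hs using (hr2 s ⟨hs.1.le, hs.2⟩).le)
  have hH : meanCurvature (X r) (ν r) p ≤ max C 1 :=
    (hC ⟨(p, r), ⟨mem_univ p, hr.1.le, hr.2⟩, rfl⟩).trans (le_max_left _ _)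
  have := hK _ ((hφpos r).trans_le hp1) hH _ (hφpos r) hp1
  linarith [hφpos r]

theorem lambdaMin_mono (hΦ : ContDiffOn ℝ ∞ Φ (Ioi 0))
    (hΦ' : ∀ x ∈ Ioi (0 : ℝ), 0 < deriv Φ x)
    (hΦ'' : ∀ x ∈ Ioi (0 : ℝ), -2 * deriv Φ x / x ≤ deriv (deriv Φ) x)
    (hflow : IsFlow Φ T X ν) (hn : 0 < n) (h0 : 0 < lambdaMin (X 0) (ν 0))
    (hpos : ∀ x ∈ Ioi (0 : ℝ), 0 < Φ x) :
    MonotoneOn (fun t => lambdaMin (X t) (ν t)) (Ico 0 T) := by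
  intro s hs t ht hst
  by_contra! hlt
  have hst' : s < t := lt_of_le_of_ne hst (by rintro rfl; exact lt_irrefl _ hlt)
  have hpt := lambdaMin_pos hΦ hΦ' hΦ'' hflow hn h0 ht
  set a := lambdaMin (X s) (ν s)
  set b := lambdaMin (X t) (ν t)
  -- The linear barrier descends from a - (a - b)/3 at s to b + (a - b)/3 at t: it starts strictly
  -- below `lambdaMin`, ends above it, and stays positive because b > 0. Touching would give 0 <
  -- Φ(H) φ² ≤ -k < 0.
  set k := (a - b) / 3 / (t - s) with hk
  have hk0 : 0 < k := div_pos (by linarith) (by linarith)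
  have hkt : k * (t - s) = (a - b) / 3 := div_mul_cancel₀ _ (by linarith)
  set φ : ℝ → ℝ := fun r => a - (a - b) / 3 - k * (r - s) with hφ
  have hφd : ∀ r, HasDerivAt φ (-k) r := by
    intro r
    have := (((hasDerivAt_id r).sub_const s).const_mul k).const_sub (a - (a - b) / 3)
    simpa using this
  obtain ⟨r, hr, hr1, hr2⟩ := exists_first_touch (f := fun s => lambdaMin (X s) (ν s)) (φ := φ)
    hs.1 ht.2 (fun r hr c hc => hflow.eventually_lt_lambdaMin hn hr hc)
    (by fun_prop) hst (by simp only [hφ, sub_self, mul_zero]; change _ < a; linarith)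
    (by simp only [hφ]; rw [hkt]; change b ≤ _; linarith)
  have hφr : 0 < φ r := by
    have := mul_le_mul_of_nonneg_left (sub_le_sub_right hr.2 s) hk0.le
    simp only [hφ]
    linarith
  obtain ⟨p, hp1, hp2⟩ := touching hΦ hΦ' hΦ'' hflow hn
    ⟨hs.1.trans_lt hr.1, hr.2.trans_lt ht.2⟩ hφr (hφd r) hr1
    (by filter_upwards [Ioo_mem_nhdsLT hr.1] with s hs using (hr2 s ⟨hs.1.le, hs.2⟩).le)
  have : 0 < Φ (meanCurvature (X r) (ν r) p) * φ r ^ 2 :=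
    mul_pos (hpos _ (hφr.trans_le hp1)) (pow_pos hφr 2)
  linarith

end IsFlow

end Global

end PhiFlow

theorem mainTheorem5 {n : ℕ} (hn : 2 ≤ n)
    {M : Type*} [TopologicalSpace M] [T2Space M] [CompactSpace M] [Nonempty M]
    [ChartedSpace (EuclideanSpace ℝ (Fin n)) M] [IsManifold (𝓡 n) ∞ M]
    (Φ : ℝ → ℝ) (hΦ : ContDiffOn ℝ ∞ Φ (Ioi 0))
    (hΦ' : ∀ x ∈ Ioi (0 : ℝ), 0 < deriv Φ x)
    (hΦ'' : ∀ x ∈ Ioi (0 : ℝ), -2 * deriv Φ x / x ≤ deriv (deriv Φ) x)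
    (T : ℝ) (hT : 0 < T) (X ν : ℝ → M → PhiFlow.Ambient n)
    (hflow : PhiFlow.IsFlow Φ T X ν)
    (hconv : PhiFlow.StrictlyConvex (X 0) (ν 0)) :
    (∀ t ∈ Ico 0 T, PhiFlow.StrictlyConvex (X t) (ν t)) ∧
    (∀ t ∈ Ico 0 T, IsLeast (PhiFlow.principalCurvatures (X t) (ν t))
      (PhiFlow.lambdaMin (X t) (ν t))) ∧
    ((∀ x ∈ Ioi (0 : ℝ), 0 < Φ x) →
      MonotoneOn (fun t => PhiFlow.lambdaMin (X t) (ν t)) (Ico 0 T)) := by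
  have hn' : 0 < n := by omega
  have h0 := (hflow.strictlyConvex_iff hn' ⟨le_rfl, hT⟩).1 hconv
  refine ⟨fun t ht => (hflow.strictlyConvex_iff hn' ht).2
    (PhiFlow.IsFlow.lambdaMin_pos hΦ hΦ' hΦ'' hflow hn' h0 ht),
    fun t ht => (hflow.lambdaMin_spec hn' ht).1,
    PhiFlow.IsFlow.lambdaMin_mono hΦ hΦ' hΦ'' hflow hn' h0⟩
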